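/- Conventions. Languages are relational: groups are structures $(G,\cdot)$ and fields are structures $(K,+,\cdot)$, with the operations given by their graphs. For a field $F$ let $H(F)$ be the Heisenberg group, the subgroup of $GL_3(F)$ of all matrices $$h(a,b,c)=\begin{pmatrix}1&a&c\\0&1&b\\0&0&1\end{pmatrix}\qquad(a,b,c\in F).$$ A copy of a structure $\mathcal B$ is a structure isomorphic to $\mathcal B$ whose universe is a subset of $\omega$; it is identified with the characteristic function of (the set of Gödel numbers of) its atomic diagram, and a function between subsets of $\omega$ is identified with the characteristic function of its graph. A pair of Turing operators $\Phi,\Psi$ is a computable functor from $\mathcal B$ to $\mathcal A$ if $\Phi$ takes copies of $\mathcal B$ to copies of $\mathcal A$; $\Psi$ takes each triple $(\mathcal B_1,p,\mathcal B_2)$, where $\mathcal B_1,\mathcal B_2$ are copies of $\mathcal B$ and $p$ is an isomorphism from $\mathcal B_1$ onto $\mathcal B_2$, to an isomorphism from $\Phi(\mathcal B_1)$ onto $\Phi(\mathcal B_2)$; and $\Psi$ preserves identity and composition. For a non-commuting pair $(u,v)$ in a copy $G$ of $H(F)$ (or in $H(F)$ itself), with $[x,y]=x^{-1}y^{-1}xy$,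 let $F_{(u,v)}=(Z(G),\oplus,\otimes_{(u,v)})$, where $\oplus$ is the group operation and $x\otimes_{(u,v)}y=z$ holds iff there are $x',y'\in G$ with $[x',u]=[y',v]=1$, $[x',v]=x$, $[u,y']=y$ and $[x',y']=z$. For $u=h(u_1,u_2,u_3)$ and $v=h(v_1,v_2,v_3)$ in $H(F)$ let $\Delta_{(u,v)}=u_1v_2-v_1u_2$ and let $g_{(u,v)}\colon F\to F_{(u,v)}$ be the function $\alpha\mapsto h(0,0,\alpha\Delta_{(u,v)})$. **Proposition.** There are Turing operators $\Phi,\Psi$ and a finitary existential formula $\psi(u,v,u',v',x,y)$ in the language of groups such that, for all fields $F$: 1. $\Phi,\Psi$ form a computable functor from $H(F)$ to $F$. 2. There are isomorphisms $f_{(u,v),(u',v')}$ from $F_{(u,v)}$ onto $F_{(u',v')}$, for all non-commuting pairs $(u,v),(u',v')$ in $H(F)$, such that $f_{(u,v),(u',v')}(g_{(u,v)}(\alpha))=g_{(u',v')}(\alpha)$ for all $\alpha\in F$, $f_{(u,v),(u,v)}$ is the identity, $f_{(u,v),(u'',v'')}=f_{(u',v'),(u'',v'')}\circ f_{(u,v),(u',v')}$,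 and, for all $x,y\in H(F)$, $H(F)\models\psi(u,v,u',v',x,y)$ iff $x\in F_{(u,v)}$ and $f_{(u,v),(u',v')}(x)=y$. 3. One can assign to each copy $G$ of $H(F)$ a non-commuting pair $(u_G,v_G)$ in $G$ such that $\Phi(G)=F_{(u_G,v_G)}$ (defined in $G$), and, for every isomorphism $p$ from a copy $G_1$ onto a copy $G_2$, $\Psi(G_1,p,G_2)$ is the function $x\mapsto f_{(p(u_{G_1}),p(v_{G_1})),(u_{G_2},v_{G_2})}(p(x))$, where the isomorphisms $f$ are carried from $H(F)$ to $G_2$ by any isomorphism from $G_2$ onto $H(F)$. -/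

import Mathlib

universe u v

namespace HeisenbergFunctor

open scoped FirstOrder

/-! ### Turing operators -/

/-- Programs for oracle computation: the usual generators of the partial recursive functions
together with one instruction `oracle` that queries the oracle. A program is a finite object
that does not depend on the oracle, so it denotes a Turing operator. -/
inductive TuringOperator : Type
  | zero : TuringOperator
  | succ : TuringOperator
  | left : TuringOperator
  | right : TuringOperator
  | oracle : TuringOperator
  | pair : TuringOperator → TuringOperator → TuringOperator
  | comp : TuringOperator → TuringOperator → TuringOperator
  | prec : TuringOperator → TuringOperator → TuringOperator
  | rfind : TuringOperator → TuringOperator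

namespace TuringOperator

/-- The partial function computed by a program with the total function `A` as oracle. -/
def eval (A : ℕ → ℕ) : TuringOperator → ℕ →. ℕ
  | zero => fun _ => Part.some 0
  | succ => fun n => Part.some (n + 1)
  | left => fun n => Part.some (Nat.unpair n).1
  | right => fun n => Part.some (Nat.unpair n).2
  | oracle => fun n => Part.some (A n)
  | pair f h => fun n => Nat.pair <$> eval A f n <*> eval A h n
  | comp f h => fun n => eval A h n >>= eval A f
  | prec f h => fun p =>
      let (a, n) := Nat.unpair p
      n.rec (eval A f a) fun y IH => do
        let i ← IH
        eval A h (Nat.pair a (Nat.pair y i))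
  | rfind f => fun a => Nat.rfind fun n => (fun m => m = 0) <$> eval A f (Nat.pair a n)

/-- With a fixed oracle `A`, the programs compute exactly the partial functions recursive
in `A`. -/
theorem exists_eval_eq_iff (A : ℕ → ℕ) (f : ℕ →. ℕ) :
    (∃ c : TuringOperator, c.eval A = f) ↔ Nat.RecursiveIn {(A : ℕ →. ℕ)} f := by
  constructor
  · rintro ⟨c, rfl⟩
    induction c with
    | zero => exact .zero
    | succ => exact .succ
    | left => exact .left
    | right => exact .right
    | oracle => exact .oracle _ rfl
    | pair f h hf hh => exact .pair hf hh
    | comp f h hf hh => exact .comp hf hh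
    | prec f h hf hh => exact .prec hf hh
    | rfind f hf => exact .rfind hf
  · intro h
    induction h with
    | zero => exact ⟨zero, rfl⟩
    | succ => exact ⟨succ, rfl⟩
    | left => exact ⟨left, rfl⟩
    | right => exact ⟨right, rfl⟩
    | oracle g hg => obtain rfl := hg; exact ⟨oracle, rfl⟩
    | pair _ _ hf hh =>
      obtain ⟨c, rfl⟩ := hf; obtain ⟨d, rfl⟩ := hh; exact ⟨pair c d, rfl⟩
    | comp _ _ hf hh =>
      obtain ⟨c, rfl⟩ := hf; obtain ⟨d, rfl⟩ := hh; exact ⟨comp c d, rfl⟩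
    | prec _ _ hf hh =>
      obtain ⟨c, rfl⟩ := hf; obtain ⟨d, rfl⟩ := hh; exact ⟨prec c d, rfl⟩
    | rfind _ hf => obtain ⟨c, rfl⟩ := hf; exact ⟨rfind c, rfl⟩

/-- The operator takes the total function `A` to the total function `B`. -/
def Takes (c : TuringOperator) (A B : ℕ → ℕ) : Prop :=
  ∀ n, c.eval A n = Part.some (B n)

end TuringOperator

/-- The characteristic function of a set of natural numbers. -/
noncomputable def charFun (S : Set ℕ) : ℕ → ℕ :=
  S.indicator fun _ => 1

/-- Three oracles presented as one. -/
def join₃ (A B C : ℕ → ℕ) (n : ℕ) : ℕ :=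
  if n % 3 = 0 then A (n / 3) else if n % 3 = 1 then B (n / 3) else C (n / 3)

/-! ### Structures with universe a subset of `ω`, and their atomic diagrams -/

/-- A structure whose universe is a subset of `ω`. -/
structure OmegaStructure (L : FirstOrder.Language.{0, 0}) where
  univ : Set ℕ
  str : L.Structure univ

instance {L : FirstOrder.Language.{0, 0}} (M : OmegaStructure L) : L.Structure M.univ := M.str

/-- `G` is a copy of `B`: a structure with universe a subset of `ω` that is isomorphic to `B`. -/
def OmegaStructure.IsCopy {L : FirstOrder.Language.{0, 0}} (G : OmegaStructure L)
    (B : Type u) [L.Structure B] : Prop :=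
  Nonempty (G.univ ≃[L] B)

/-- Atomic sentences of a relational language with natural numbers as names of elements. -/
inductive AtomicSentence (L : FirstOrder.Language.{0, 0}) : Type
  | eq (a b : ℕ) : AtomicSentence L
  | rel {n : ℕ} (R : L.Relations n) (a : Fin n → ℕ) : AtomicSentence L

namespace AtomicSentence

variable {L : FirstOrder.Language.{0, 0}}

/-- All elements named in the sentence belong to the universe of `M`. -/
def NamesIn (M : OmegaStructure L) : AtomicSentence L → Prop
  | eq a b => a ∈ M.univ ∧ b ∈ M.univ
  | rel _ a => ∀ i, a i ∈ M.univ

/-- All elements named in the sentence belong to the universe of `M`, and it is true in `M`. -/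
def TrueIn (M : OmegaStructure L) : AtomicSentence L → Prop
  | eq a b => a ∈ M.univ ∧ b ∈ M.univ ∧ a = b
  | rel R a => ∃ h : ∀ i, a i ∈ M.univ,
      FirstOrder.Language.Structure.RelMap R (fun i => (⟨a i, h i⟩ : M.univ))

/-- Gödel numbers of atomic sentences. -/
def godel [∀ n, Encodable (L.Relations n)] : AtomicSentence L → ℕ
  | eq a b => Nat.pair 0 (Nat.pair a b)
  | @rel _ n R a =>
      Nat.pair 1 (Nat.pair n (Nat.pair (Encodable.encode R) (Encodable.encode (List.ofFn a))))

end AtomicSentence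

/-- The atomic diagram of a structure, as a set of Gödel numbers: the atomic sentences (tagged
`0`) and the negations of atomic sentences (tagged `1`) that are true in the structure. -/
def atomicDiagram {L : FirstOrder.Language.{0, 0}} [L.IsRelational] [∀ n, Encodable (L.Relations n)]
    (M : OmegaStructure L) : Set ℕ :=
  {k | ∃ φ : AtomicSentence L,
    (φ.TrueIn M ∧ k = Nat.pair 0 φ.godel) ∨
    (φ.NamesIn M ∧ ¬ φ.TrueIn M ∧ k = Nat.pair 1 φ.godel)}

/-- The graph of a function between subsets of `ω`, as a set of coded pairs. -/
def graphCode {X Y : Set ℕ} (p : X → Y) : Set ℕ :=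
  {k | ∃ x : X, k = Nat.pair x (p x)}

/-! ### Computable functors -/

section Functor

variable {L : FirstOrder.Language.{0, 0}} [L.IsRelational] [∀ n, Encodable (L.Relations n)]

/-- A structure identified with the characteristic function of its atomic diagram. -/
noncomputable def structureCode (M : OmegaStructure L) : ℕ → ℕ :=
  charFun (atomicDiagram M)

/-- A map between structures identified with the characteristic function of its graph. -/
noncomputable def mapCode {M N : OmegaStructure L} (p : M.univ ≃[L] N.univ) : ℕ → ℕ :=
  charFun (graphCode p)

/-- A triple `(G₁, p, G₂)` identified with a function on `ω`. -/
noncomputable def tripleCode {G₁ G₂ : OmegaStructure L} (p : G₁.univ ≃[L] G₂.univ) : ℕ → ℕ :=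
  join₃ (structureCode G₁) (mapCode p) (structureCode G₂)

end Functor

/-- The Turing operators `Φ, Ψ` form a computable functor from `B` to `A`. (A structure with
universe a subset of `ω` is determined by its atomic diagram, so `K` in the clauses below is
the structure `Φ(G)`.) -/
structure IsComputableFunctor (L L' : FirstOrder.Language.{0, 0})
    [L.IsRelational] [∀ n, Encodable (L.Relations n)]
    [L'.IsRelational] [∀ n, Encodable (L'.Relations n)]
    (Φ Ψ : TuringOperator) (B : Type u) [L.Structure B] (A : Type v) [L'.Structure A] : Prop where
  /-- `Φ` takes copies of `B` to copies of `A`. -/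
  obj : ∀ G : OmegaStructure L, G.IsCopy B →
    ∃ K : OmegaStructure L', K.IsCopy A ∧ Φ.Takes (structureCode G) (structureCode K)
  /-- `Ψ` takes `(G₁, p, G₂)`, where `p` is an isomorphism from `G₁` onto `G₂`, to an
  isomorphism from `Φ(G₁)` onto `Φ(G₂)`. -/
  map : ∀ (G₁ G₂ : OmegaStructure L) (K₁ K₂ : OmegaStructure L'), G₁.IsCopy B → G₂.IsCopy B →
    Φ.Takes (structureCode G₁) (structureCode K₁) →
    Φ.Takes (structureCode G₂) (structureCode K₂) →
    ∀ p : G₁.univ ≃[L] G₂.univ, ∃ q : K₁.univ ≃[L'] K₂.univ, Ψ.Takes (tripleCode p) (mapCode q)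
  /-- `Ψ` preserves identity. -/
  map_id : ∀ (G : OmegaStructure L) (K : OmegaStructure L'), G.IsCopy B →
    Φ.Takes (structureCode G) (structureCode K) →
    Ψ.Takes (tripleCode (FirstOrder.Language.Equiv.refl L G.univ))
      (mapCode (FirstOrder.Language.Equiv.refl L' K.univ))
  /-- `Ψ` preserves composition. -/
  map_comp : ∀ (G₁ G₂ G₃ : OmegaStructure L) (K₁ K₂ K₃ : OmegaStructure L'),
    G₁.IsCopy B → G₂.IsCopy B → G₃.IsCopy B →
    Φ.Takes (structureCode G₁) (structureCode K₁) →
    Φ.Takes (structureCode G₂) (structureCode K₂) →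
    Φ.Takes (structureCode G₃) (structureCode K₃) →
    ∀ (p₁ : G₁.univ ≃[L] G₂.univ) (p₂ : G₂.univ ≃[L] G₃.univ)
      (q₁ : K₁.univ ≃[L'] K₂.univ) (q₂ : K₂.univ ≃[L'] K₃.univ),
    Ψ.Takes (tripleCode p₁) (mapCode q₁) → Ψ.Takes (tripleCode p₂) (mapCode q₂) →
    Ψ.Takes (tripleCode (p₂.comp p₁)) (mapCode (q₂.comp q₁))

/-! ### Groups and fields as relational structures -/

/-- The relation symbol for groups: the graph of multiplication. -/
inductive GroupRel : ℕ → Type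
  | mul : GroupRel 3

/-- The relation symbols for fields: the graphs of addition and of multiplication. -/
inductive FieldRel : ℕ → Type
  | add : FieldRel 3
  | mul : FieldRel 3

/-- The language of groups, with a ternary relation symbol for `x * y = z`. -/
def groupLang : FirstOrder.Language.{0, 0} := ⟨fun _ => Empty, GroupRel⟩

/-- The language of fields, with ternary relation symbols for `x + y = z` and `x * y = z`. -/
def fieldLang : FirstOrder.Language.{0, 0} := ⟨fun _ => Empty, FieldRel⟩

/-- The symbol of `groupLang`. -/
def mulSymbol : groupLang.Relations 3 := GroupRel.mul

instance : groupLang.IsRelational := fun _ => inferInstanceAs (IsEmpty Empty)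

instance : fieldLang.IsRelational := fun _ => inferInstanceAs (IsEmpty Empty)

instance : ∀ n, Encodable (groupLang.Relations n)
  | 3 => { encode := fun _ => 0, decode := fun _ => some GroupRel.mul
           encodek := by rintro ⟨⟩; rfl }
  | 0 | 1 | 2 | _ + 4 => { encode := fun _ => 0, decode := fun _ => none
                           encodek := by rintro ⟨⟩ }

instance : ∀ n, Encodable (fieldLang.Relations n)
  | 3 => { encode := fun R => match R with
             | FieldRel.add => 0
             | FieldRel.mul => 1
           decode := fun k => match k with
             | 0 => some FieldRel.add
             | 1 => some FieldRel.mul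
             | _ => none
           encodek := by rintro ⟨⟩ <;> rfl }
  | 0 | 1 | 2 | _ + 4 => { encode := fun _ => 0, decode := fun _ => none
                           encodek := by rintro ⟨⟩ }

/-- `x * y = z` in a structure for the language of groups. -/
def IsMul {G : Type u} [groupLang.Structure G] (x y z : G) : Prop :=
  FirstOrder.Language.Structure.RelMap mulSymbol ![x, y, z]

/-- A field as a structure for the language of fields. -/
instance fieldStructure (F : Type u) [Field F] : fieldLang.Structure F where
  funMap := fun f => nomatch f
  RelMap := fun R => match R with
    | FieldRel.add => fun a => a 0 + a 1 = a 2
    | FieldRel.mul => fun a => a 0 * a 1 = a 2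

/-! ### The Heisenberg group -/

section Heisenberg

variable {F : Type u} [Field F]

/-- The matrix `h(a, b, c)`. -/
def hMatrix (a b c : F) : GL (Fin 3) F where
  val := !![1, a, c; 0, 1, b; 0, 0, 1]
  inv := !![1, -a, a * b - c; 0, 1, -b; 0, 0, 1]
  val_inv := by
    ext i j
    fin_cases i <;> fin_cases j <;> simp [Matrix.mul_apply, Fin.sum_univ_three]
    ring
  inv_val := by
    ext i j
    fin_cases i <;> fin_cases j <;> simp [Matrix.mul_apply, Fin.sum_univ_three]
    ring

theorem hMatrix_mul (a b c a' b' c' : F) :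
    hMatrix a b c * hMatrix a' b' c' = hMatrix (a + a') (b + b') (c + c' + a * b') := by
  ext i j
  fin_cases i <;> fin_cases j <;>
    simp [hMatrix, Matrix.mul_apply, Fin.sum_univ_three] <;> ring

theorem hMatrix_inv (a b c : F) : (hMatrix a b c)⁻¹ = hMatrix (-a) (-b) (a * b - c) := by
  apply Units.ext
  rfl

variable (F) in
/-- The Heisenberg group: the subgroup of `GL₃(F)` of all matrices `h(a, b, c)`. -/
def heisenbergSubgroup : Subgroup (GL (Fin 3) F) where
  carrier := {x | ∃ a b c, x = hMatrix a b c}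
  mul_mem' := by
    rintro _ _ ⟨a, b, c, rfl⟩ ⟨a', b', c', rfl⟩
    exact ⟨_, _, _, hMatrix_mul a b c a' b' c'⟩
  one_mem' := by
    refine ⟨0, 0, 0, ?_⟩
    ext i j
    fin_cases i <;> fin_cases j <;> simp [hMatrix]
  inv_mem' := by
    rintro _ ⟨a, b, c, rfl⟩
    exact ⟨_, _, _, hMatrix_inv a b c⟩

variable (F) in
/-- `H(F)`, as a group. -/
abbrev Heisenberg : Type u := heisenbergSubgroup F

/-- `H(F)` as a structure for the language of groups. -/
instance heisenbergStructure : groupLang.Structure (Heisenberg F) where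
  funMap := fun f => nomatch f
  RelMap := fun R => match R with
    | GroupRel.mul => fun a => a 0 * a 1 = a 2

/-- `h(a, b, c)` as an element of `H(F)`. -/
def hElem (a b c : F) : Heisenberg F := ⟨hMatrix a b c, a, b, c, rfl⟩

/-- The determinant `Δ_(u,v) = u₁ v₂ - v₁ u₂` for `u = h(u₁, u₂, u₃)`, `v = h(v₁, v₂, v₃)`. -/
def Delta (u v : Heisenberg F) : F :=
  Matrix.det !![u.1.1 0 1, v.1.1 0 1; u.1.1 1 2, v.1.1 1 2]

/-- The commutator `[x, y] = x⁻¹ y⁻¹ x y`. -/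
def comm (x y : Heisenberg F) : Heisenberg F := x⁻¹ * y⁻¹ * x * y

theorem hElem_mem_center (c : F) : hElem 0 0 c ∈ Subgroup.center (Heisenberg F) := by
  rw [Subgroup.mem_center_iff]
  rintro ⟨_, a', b', c', rfl⟩
  apply Subtype.ext
  change hMatrix a' b' c' * hMatrix 0 0 c = hMatrix 0 0 c * hMatrix a' b' c'
  rw [hMatrix_mul, hMatrix_mul]
  congr 1 <;> ring

end Heisenberg

/-- The non-commuting pairs of elements of a group `G`. -/
def NCPair (G : Type u) [groupLang.Structure G] : Type u :=
  {w : G × G // ¬ ∃ z, IsMul w.1 w.2 z ∧ IsMul w.2 w.1 z}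

/-- The image of a non-commuting pair under an isomorphism. -/
def NCPair.map {G : Type u} {G' : Type v} [groupLang.Structure G] [groupLang.Structure G']
    (θ : G ≃[groupLang] G') (w : NCPair G) : NCPair G' :=
  ⟨(θ w.1.1, θ w.1.2), by
    rintro ⟨z, hz⟩
    refine w.2 ⟨θ.symm z, ?_⟩
    have key : ∀ x y : G, IsMul (θ x) (θ y) z → IsMul x y (θ.symm z) := by
      intro x y hxy
      unfold IsMul at hxy ⊢
      rw [← θ.map_rel]
      convert hxy using 1
      funext i
      fin_cases i <;> simp
    exact ⟨key _ _ hz.1, key _ _ hz.2⟩⟩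

/-! ### The fields defined in the Heisenberg group -/

section Maltsev

variable {F : Type u} [Field F]

/-- The underlying set of the field `F_(u,v)` defined in `H(F)`: the center of `H(F)`. -/
def MaltsevField (_w : NCPair (Heisenberg F)) : Type u := Subgroup.center (Heisenberg F)

/-- An element of `F_(u,v)` as an element of `H(F)`. -/
def MaltsevField.toH {w : NCPair (Heisenberg F)} (x : MaltsevField w) : Heisenberg F := x.1

/-- The operations of `F_(u,v)`: the sum is the product in `H(F)`, and the product of `x` and `y`
is `z` if there are `x', y'` with `[x',u] = [y',v] = 1`, `[x',v] = x`, `[u,y'] = y` and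
`[x',y'] = z`. -/
instance maltsevStructure (w : NCPair (Heisenberg F)) : fieldLang.Structure (MaltsevField w) where
  funMap := fun f => nomatch f
  RelMap := fun R => match R with
    | FieldRel.add => fun a => (a 0).toH * (a 1).toH = (a 2).toH
    | FieldRel.mul => fun a => ∃ x' y' : Heisenberg F,
        comm x' w.1.1 = 1 ∧ comm y' w.1.2 = 1 ∧
        comm x' w.1.2 = (a 0).toH ∧ comm w.1.1 y' = (a 1).toH ∧ comm x' y' = (a 2).toH

/-- The function `g_(u,v)` from `F` to `F_(u,v)`, taking `α` to `h(0, 0, α Δ_(u,v))`. -/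
def gMap (w : NCPair (Heisenberg F)) (α : F) : MaltsevField w :=
  ⟨hElem 0 0 (α * Delta w.1.1 w.1.2), hElem_mem_center _⟩

/-- Let `θ` be an isomorphism from `G` onto `H(F)`, and let `θ` take the non-commuting pair
`(u,v)` of `G` to `w`. Then `κ` shows that the structure `K` is the field `F_(u,v)` as it is
defined in `G`: `K` consists of elements of `G`, and `θ` restricts to an isomorphism `κ` from `K`
onto `F_w`. -/
def IsRestriction {G : OmegaStructure groupLang} {K : OmegaStructure fieldLang}
    (θ : G.univ ≃[groupLang] Heisenberg F) {w : NCPair (Heisenberg F)}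
    (κ : K.univ ≃[fieldLang] MaltsevField w) : Prop :=
  ∀ x : K.univ, ∃ hx : (x : ℕ) ∈ G.univ, θ ⟨x, hx⟩ = (κ x).toH

end Maltsev

end HeisenbergFunctor

open HeisenbergFunctor
open scoped FirstOrder

/-! Modulo its center, H(F) is the plane F², and the commutator is the determinant: [x,y] =
h(0,0,Δ(x,y)) (`comm_eq_hElem`). If Δ(u,v) ≠ 0, then an element commuting with both u and v is
central (`mem_center_of_commute`). The conditions on x', y' in the definition of ⊗ make them
multiples αu and βv modulo the center, so [x',v], [u,y'] and [x',y'] are αΔ, βΔ and αβΔ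
(`maltsevMul_iff`). Hence g_(u,v) is an isomorphism (`gEquiv`), and f is g_(u',v') after the inverse
of g_(u,v), which makes the identity and composition laws immediate.

This f is definable because [u',v'] is itself the element of F_(u,v) that rescales Δ(u,v) to
Δ(u',v'): f(x) = y says x ⊗_(u,v) [u',v'] = y (`maltsevMul_comm_iff`). Written with products only,
this is an existential formula.

For computability, one program searches the diagram of G for a non-commuting pair. Given the pair,
each question about the diagram of F_(u,v), or about the graph of the map between two such fields,
has a finite list of numbers that settles it, and every such list yields the same answer. A blind
search through coded lists is therefore total and correct on copies of H(F), uniformly in the oracle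
and in F (`exists_search_decide`, `fieldValue_iff`, `mapValue_iff`). Membership in F_(u,v) can be
decided because the universe can be read off the equations a = a and only two products have to be
compared.

Functoriality is seen by indexing with F. Each element of the defined field is the name of
g_(u,v)(α) for a unique α. If G₁ is read through θ ∘ p and G₂ through θ, then p becomes the identity
of H(F) and the map computed by Ψ sends the name of α to the name of α (`exists_operators`,
`mapCode_eq_iff`). -/

namespace HeisenbergFunctor

open Encodable

/-! ### Uniform oracle computability -/

namespace TuringOperator

/-- The quantifier order is the point: the program is chosen before the oracle, whereas
`exists_eval_eq_iff` yields a program for one fixed oracle. -/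
theorem exists_eval_eq_of_partrec {f : ℕ →. ℕ} (hf : Nat.Partrec f) :
    ∃ c : TuringOperator, ∀ A, c.eval A = f := by
  induction hf with
  | zero => exact ⟨zero, fun _ => rfl⟩
  | succ => exact ⟨succ, fun _ => rfl⟩
  | left => exact ⟨left, fun _ => rfl⟩
  | right => exact ⟨right, fun _ => rfl⟩
  | pair _ _ hf hg =>
    obtain ⟨c, hc⟩ := hf; obtain ⟨d, hd⟩ := hg
    exact ⟨pair c d, fun A => by simp only [eval, hc, hd]; rfl⟩
  | comp _ _ hf hg =>
    obtain ⟨c, hc⟩ := hf; obtain ⟨d, hd⟩ := hg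
    exact ⟨comp c d, fun A => by simp only [eval, hc, hd]; rfl⟩
  | prec _ _ hf hg =>
    obtain ⟨c, hc⟩ := hf; obtain ⟨d, hd⟩ := hg
    exact ⟨prec c d, fun A => by simp only [eval, hc, hd]; rfl⟩
  | rfind _ hf =>
    obtain ⟨c, hc⟩ := hf
    exact ⟨rfind c, fun A => by simp only [eval, hc]; rfl⟩

/-- Replace every oracle query `n` by the query computed by `s` from `n`. -/
def precompOracle (s : TuringOperator) : TuringOperator → TuringOperator
  | zero => zero
  | succ => succ
  | left => left
  | right => right
  | oracle => comp oracle s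
  | pair f h => pair (precompOracle s f) (precompOracle s h)
  | comp f h => comp (precompOracle s f) (precompOracle s h)
  | prec f h => prec (precompOracle s f) (precompOracle s h)
  | rfind f => rfind (precompOracle s f)

/-- This lets the pair-finding program run on a single component of a joined oracle. -/
theorem eval_precompOracle {s : TuringOperator} {g : ℕ → ℕ} {A : ℕ → ℕ}
    (hs : ∀ n, s.eval A n = Part.some (g n)) (c : TuringOperator) :
    (precompOracle s c).eval A = c.eval (fun n => A (g n)) := by
  induction c with
  | zero | succ | left | right => rfl
  | oracle => funext n; simp [precompOracle, eval, hs]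
  | pair _ _ hf hg | comp _ _ hf hg | prec _ _ hf hg =>
    simp only [precompOracle, eval, hf, hg]; rfl
  | rfind _ hf => simp only [precompOracle, eval, hf]; rfl

theorem eval_pair_some {c d : TuringOperator} {A : ℕ → ℕ} {n a b : ℕ}
    (hc : c.eval A n = Part.some a) (hd : d.eval A n = Part.some b) :
    (pair c d).eval A n = Part.some (Nat.pair a b) := by
  simp [eval, hc, hd, Seq.seq]

theorem eval_comp_some {c d : TuringOperator} {A : ℕ → ℕ} {n a : ℕ}
    (hd : d.eval A n = Part.some a) : (comp c d).eval A n = c.eval A a := by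
  simp only [eval, hd]
  exact Part.bind_some _ _

end TuringOperator

section OracleComputable

open TuringOperator

variable {α β γ δ : Type} [Primcodable α] [Primcodable β] [Primcodable γ] [Primcodable δ]

/-- A total function that is computed by one program from every oracle. -/
def OracleComputable (f : (ℕ → ℕ) → α → β) : Prop :=
  ∃ c : TuringOperator, ∀ A a, c.eval A (encode a) = Part.some (encode (f A a))

/-- A relation between oracles and data that is decided by one program from every oracle. -/
def OracleDecidable (P : (ℕ → ℕ) → α → Prop) : Prop :=
  ∃ b : (ℕ → ℕ) → α → Bool, OracleComputable b ∧ ∀ A a, b A a = true ↔ P A a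

theorem _root_.Computable.oracleComputable {f : α → β} (hf : Computable f) :
    OracleComputable fun _ => f := by
  obtain ⟨c, hc⟩ := exists_eval_eq_of_partrec hf
  exact ⟨c, fun A a => by simp [hc]⟩

namespace OracleComputable

theorem comp {f : (ℕ → ℕ) → β → γ} {g : (ℕ → ℕ) → α → β} (hf : OracleComputable f)
    (hg : OracleComputable g) : OracleComputable fun A a => f A (g A a) := by
  obtain ⟨c, hc⟩ := hf
  obtain ⟨d, hd⟩ := hg
  exact ⟨c.comp d, fun A a => by rw [eval_comp_some (hd A a), hc]⟩

theorem pair {f : (ℕ → ℕ) → α → β} {g : (ℕ → ℕ) → α → γ} (hf : OracleComputable f)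
    (hg : OracleComputable g) : OracleComputable fun A a => (f A a, g A a) := by
  obtain ⟨c, hc⟩ := hf
  obtain ⟨d, hd⟩ := hg
  exact ⟨c.pair d, fun A a => by rw [eval_pair_some (hc A a) (hd A a)]; rfl⟩

theorem oracle : OracleComputable fun A n => A n :=
  ⟨.oracle, fun _ _ => rfl⟩

end OracleComputable

namespace OracleDecidable

theorem of_computablePred {P : α → Prop} (hP : ComputablePred P) :
    OracleDecidable fun _ => P := by
  obtain ⟨_, h⟩ := hP
  exact ⟨_, h.oracleComputable, fun _ _ => by simp⟩

theorem of_primrecPred {P : α → Prop} (hP : PrimrecPred P) : OracleDecidable fun _ => P := by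
  obtain ⟨_, h⟩ := hP
  exact of_computablePred ⟨_, h.to_comp⟩

theorem eq_nat {f g : α → ℕ} (hf : Primrec f) (hg : Primrec g) :
    OracleDecidable fun _ a => f a = g a :=
  of_primrecPred (Primrec.eq.comp hf hg)

theorem not {P : (ℕ → ℕ) → α → Prop} (hP : OracleDecidable P) :
    OracleDecidable fun A a => ¬ P A a := by
  obtain ⟨b, hb, h⟩ := hP
  exact ⟨_, (Primrec.not.to_comp.oracleComputable).comp hb, fun A a => by simp [← h]⟩

theorem and {P Q : (ℕ → ℕ) → α → Prop} (hP : OracleDecidable P) (hQ : OracleDecidable Q) :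
    OracleDecidable fun A a => P A a ∧ Q A a := by
  obtain ⟨b, hb, h⟩ := hP
  obtain ⟨b', hb', h'⟩ := hQ
  exact ⟨_, (Primrec.and.to_comp.oracleComputable).comp (hb.pair hb'),
    fun A a => by simp [← h, ← h']⟩

theorem of_iff {P Q : (ℕ → ℕ) → α → Prop} (hP : OracleDecidable P)
    (h : ∀ A a, P A a ↔ Q A a) : OracleDecidable Q := by
  obtain rfl : P = Q := by funext A a; exact propext (h A a)
  exact hP

theorem or {P Q : (ℕ → ℕ) → α → Prop} (hP : OracleDecidable P) (hQ : OracleDecidable Q) :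
    OracleDecidable fun A a => P A a ∨ Q A a :=
  (hP.not.and hQ.not).not.of_iff fun A a => by tauto

theorem imp {P Q : (ℕ → ℕ) → α → Prop} (hP : OracleDecidable P) (hQ : OracleDecidable Q) :
    OracleDecidable fun A a => P A a → Q A a :=
  (hP.not.or hQ).of_iff fun A a => by tauto

theorem query {q : α → ℕ} (hq : Primrec q) : OracleDecidable fun A a => A (q a) = 1 := by
  obtain ⟨b, hb, h⟩ := of_primrecPred (Primrec.eq.comp (Primrec.id (α := ℕ)) (Primrec.const 1))
  refine ⟨_, hb.comp (OracleComputable.oracle.comp hq.to_comp.oracleComputable), fun A a => ?_⟩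
  rw [h]
  rfl

/-- Unbounded search halts as soon as a witness exists, since each test is total for every oracle.
-/
theorem exists_search {P : (ℕ → ℕ) → α × ℕ → Prop} (hP : OracleDecidable P) :
    ∃ c : TuringOperator, ∀ A a, (∃ w, P A (a, w)) →
      ∃ w, P A (a, w) ∧ c.eval A (encode a) = Part.some w := by
  obtain ⟨b, hb, h⟩ := hP
  -- `rfind` looks for the value 0, and `false` is encoded by 0, so the test is negated.
  obtain ⟨c, hc⟩ := (Primrec.encode.comp Primrec.not).to_comp.oracleComputable.comp hb
  refine ⟨.rfind c, fun A a ⟨w, hw⟩ => ?_⟩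
  have key : (TuringOperator.rfind c).eval A (encode a) =
      Nat.rfind (fun n => Part.some (b A (a, n))) := by
    change Nat.rfind _ = _
    congr 1
    funext n
    have := hc A (a, n)
    simp only [encode_prod_val, encode_nat] at this
    rw [this]
    cases b A (a, n) <;> simp
  obtain ⟨n, hn, -⟩ := Nat.rfind_min' (p := fun n => b A (a, n)) (m := w) ((h _ _).2 hw)
  refine ⟨n, ?_, key.trans (Part.eq_some_iff.2 hn)⟩
  rw [← h]
  exact (Part.mem_some_iff.1 (Nat.rfind_spec hn)).symm

/-- The program that searches for a witness for `S` and then decides `V`. -/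
theorem exists_search_decide {S V : (ℕ → ℕ) → α × ℕ → Prop} (hS : OracleDecidable S)
    (hV : OracleDecidable V) :
    ∃ c : TuringOperator, ∀ A a, (∃ w, S A (a, w)) →
      ∀ r : ℕ, (∀ w, S A (a, w) → (V A (a, w) ∧ r = 1 ∨ ¬ V A (a, w) ∧ r = 0)) →
        c.eval A (encode a) = Part.some r := by
  obtain ⟨c, hc⟩ := hS.exists_search
  obtain ⟨b, ⟨d, hd⟩, hb⟩ := hV
  obtain ⟨i, hi⟩ := (Computable.id (α := α)).oracleComputable
  refine ⟨.comp d (.pair i c), fun A a hw r hr => ?_⟩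
  obtain ⟨w, hSw, hcw⟩ := hc A a hw
  rw [eval_comp_some (eval_pair_some (hi A a) hcw)]
  have := hd A (a, w)
  simp only [encode_prod_val, encode_nat] at this
  simp only [id]
  rw [this]
  rcases hr w hSw with ⟨hv, rfl⟩ | ⟨hv, rfl⟩
  · rw [(hb _ _).2 hv]; rfl
  · rw [Bool.eq_false_iff.2 fun h => hv ((hb _ _).1 h)]; rfl

end OracleDecidable

end OracleComputable

open scoped FirstOrder

/-! ### Algebra of the Heisenberg group -/

section Algebra

variable {F : Type u} [Field F]

theorem hElem_surj (x : Heisenberg F) : ∃ a b c, x = hElem a b c := by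
  obtain ⟨_, a, b, c, rfl⟩ := x
  exact ⟨a, b, c, rfl⟩

theorem hElem_mul (a b c a' b' c' : F) :
    hElem a b c * hElem a' b' c' = hElem (a + a') (b + b') (c + c' + a * b') :=
  Subtype.ext (hMatrix_mul a b c a' b' c')

theorem hElem_inj {a b c a' b' c' : F} :
    hElem a b c = hElem a' b' c' ↔ a = a' ∧ b = b' ∧ c = c' := by
  refine ⟨fun h => ?_, by rintro ⟨rfl, rfl, rfl⟩; rfl⟩
  have h' : ∀ i j, (hElem a b c).1.1 i j = (hElem a' b' c').1.1 i j := by simp [h]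
  exact ⟨by simpa [hElem, hMatrix] using h' 0 1, by simpa [hElem, hMatrix] using h' 1 2,
    by simpa [hElem, hMatrix] using h' 0 2⟩

theorem hElem_zero : hElem 0 0 0 = (1 : Heisenberg F) := by
  have h := hElem_mul (0 : F) 0 0 0 0 0
  simpa using h

theorem Delta_hElem (a b c a' b' c' : F) :
    Delta (hElem a b c) (hElem a' b' c') = a * b' - a' * b := by
  simp [Delta, hElem, hMatrix]

/-- Eliminates inverses, since the language has only the graph of multiplication. -/
theorem comm_eq_iff {x y z : Heisenberg F} : comm x y = z ↔ x * y = y * x * z := by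
  unfold comm
  rw [← mul_right_inj (y * x)]
  group

theorem comm_eq_hElem (x y : Heisenberg F) : comm x y = hElem 0 0 (Delta x y) := by
  obtain ⟨a, b, c, rfl⟩ := hElem_surj x
  obtain ⟨a', b', c', rfl⟩ := hElem_surj y
  rw [comm_eq_iff, Delta_hElem]
  simp only [hElem_mul, hElem_inj]
  refine ⟨by ring, by ring, by ring⟩

theorem commute_iff_Delta {x y : Heisenberg F} : x * y = y * x ↔ Delta x y = 0 := by
  rw [← mul_one (y * x), ← comm_eq_iff, comm_eq_hElem, ← hElem_zero, hElem_inj]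
  simp

theorem isMul_iff {x y z : Heisenberg F} : IsMul x y z ↔ x * y = z :=
  Iff.rfl

theorem NCPair.Delta_ne_zero (w : NCPair (Heisenberg F)) : Delta w.1.1 w.1.2 ≠ 0 := by
  intro h
  exact w.2 ⟨_, isMul_iff.2 rfl, isMul_iff.2 (commute_iff_Delta.2 h).symm⟩

/-- Commuting with u and v is a homogeneous linear system in the first two coordinates of x with
determinant Δ(u,v) up to sign; Cramer's rule makes both vanish. -/
theorem mem_center_of_commute {u v x : Heisenberg F} (h : Delta u v ≠ 0) (hu : x * u = u * x)
    (hv : x * v = v * x) : ∃ α, x = hElem 0 0 (α * Delta u v) := by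
  obtain ⟨a, b, c, rfl⟩ := hElem_surj u
  obtain ⟨a', b', c', rfl⟩ := hElem_surj v
  obtain ⟨p, q, r, rfl⟩ := hElem_surj x
  rw [commute_iff_Delta] at hu hv
  simp only [Delta_hElem] at *
  refine ⟨r / (a * b' - a' * b), hElem_inj.2 ⟨?_, ?_, ?_⟩⟩
  · apply mul_right_cancel₀ h; linear_combination a * hv - a' * hu
  · apply mul_right_cancel₀ h; linear_combination b * hv - b' * hu
  · rw [div_mul_cancel₀ _ h]

theorem hElem_center_mul (c d : F) : hElem 0 0 c * hElem 0 0 d = hElem 0 0 (c + d) := by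
  rw [hElem_mul, hElem_inj]; simp

/-- The graph of the multiplication of `F_(u,v)`. -/
def MaltsevMul (u v x y z : Heisenberg F) : Prop :=
  ∃ x' y' : Heisenberg F,
    comm x' u = 1 ∧ comm y' v = 1 ∧ comm x' v = x ∧ comm u y' = y ∧ comm x' y' = z

/-- Modulo the center, x' lies on the line of u and y' on the line of v; bilinearity of the
determinant does the rest. The ratios α, β are read off by pairing x' with v and u with y'. -/
theorem maltsevMul_iff {u v : Heisenberg F} (h : Delta u v ≠ 0) {x y z : Heisenberg F} :
    MaltsevMul u v x y z ↔ ∃ α β, x = hElem 0 0 (α * Delta u v) ∧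
      y = hElem 0 0 (β * Delta u v) ∧ z = hElem 0 0 (α * β * Delta u v) := by
  simp only [MaltsevMul, comm_eq_hElem, ← hElem_zero, hElem_inj, true_and]
  obtain ⟨u₁, u₂, u₃, rfl⟩ := hElem_surj u
  obtain ⟨v₁, v₂, v₃, rfl⟩ := hElem_surj v
  constructor
  · rintro ⟨x', y', hx, hy, rfl, rfl, rfl⟩
    obtain ⟨x₁, x₂, x₃, rfl⟩ := hElem_surj x'
    obtain ⟨y₁, y₂, y₃, rfl⟩ := hElem_surj y'
    simp only [Delta_hElem] at *
    refine ⟨(x₁ * v₂ - v₁ * x₂) / (u₁ * v₂ - v₁ * u₂), (u₁ * y₂ - y₁ * u₂) / (u₁ * v₂ - v₁ * u₂),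
      ?_, ?_, ?_⟩
    · rw [div_mul_cancel₀ _ h]
    · rw [div_mul_cancel₀ _ h]
    · rw [hElem_inj]
      refine ⟨rfl, rfl, ?_⟩
      rw [mul_assoc, div_mul_cancel₀ _ h, div_mul_eq_mul_div, eq_div_iff h]
      -- The Plücker relation Δ(x',y')Δ(u,v) = Δ(x',v)Δ(u,y') + Δ(y',v)Δ(x',u), whose last term
      -- vanishes because x' commutes with u.
      linear_combination (y₁ * v₂ - v₁ * y₂) * hx
  · rintro ⟨α, β, rfl, rfl, rfl⟩
    refine ⟨hElem (α * u₁) (α * u₂) 0, hElem (β * v₁) (β * v₂) 0, ?_⟩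
    simp only [Delta_hElem, hElem_inj, true_and]
    refine ⟨by ring, by ring, by ring, by ring, by ring⟩

/-- The function `g_(u,v)` as an isomorphism of fields. -/
noncomputable def gEquiv (w : NCPair (Heisenberg F)) : F ≃[fieldLang] MaltsevField w where
  toEquiv := Equiv.ofBijective (gMap w) (by
    have hΔ := w.Delta_ne_zero
    constructor
    · intro α β h
      have h' := congrArg MaltsevField.toH h
      exact mul_right_cancel₀ hΔ (hElem_inj.1 h').2.2
    · intro x
      obtain ⟨α, hα⟩ := mem_center_of_commute hΔ
        (Subgroup.mem_center_iff.1 x.2 w.1.1).symm (Subgroup.mem_center_iff.1 x.2 w.1.2).symm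
      exact ⟨α, Subtype.ext hα.symm⟩)
  map_fun' := fun f => nomatch f
  map_rel' := by
    have hΔ := w.Delta_ne_zero
    intro n R a
    cases R with
    | add =>
      change hElem 0 0 _ * hElem 0 0 _ = hElem 0 0 _ ↔ a 0 + a 1 = a 2
      rw [hElem_center_mul, hElem_inj, ← add_mul]
      simp [hΔ]
    | mul =>
      change MaltsevMul w.1.1 w.1.2 (hElem 0 0 (a 0 * _)) (hElem 0 0 (a 1 * _))
        (hElem 0 0 (a 2 * _)) ↔ a 0 * a 1 = a 2
      rw [maltsevMul_iff hΔ]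
      simp only [hElem_inj, true_and]
      constructor
      · rintro ⟨α, β, h₁, h₂, h₃⟩
        rw [mul_right_cancel₀ hΔ h₁, mul_right_cancel₀ hΔ h₂, mul_right_cancel₀ hΔ h₃]
      · intro h
        exact ⟨_, _, rfl, rfl, by rw [h]⟩

theorem gEquiv_apply (w : NCPair (Heisenberg F)) (α : F) : gEquiv w α = gMap w α :=
  rfl

/-- The isomorphism `f_(w,w')`. -/
noncomputable def fEquiv (w w' : NCPair (Heisenberg F)) :
    MaltsevField w ≃[fieldLang] MaltsevField w' :=
  (gEquiv w').comp (gEquiv w).symm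

theorem fEquiv_gMap (w w' : NCPair (Heisenberg F)) (α : F) :
    fEquiv w w' (gMap w α) = gMap w' α := by
  rw [← gEquiv_apply, ← gEquiv_apply]
  simp [fEquiv]

theorem exists_gMap_eq {w : NCPair (Heisenberg F)} (x : MaltsevField w) : ∃ α, gMap w α = x :=
  (gEquiv w).surjective x

theorem fEquiv_self (w : NCPair (Heisenberg F)) :
    fEquiv w w = FirstOrder.Language.Equiv.refl fieldLang (MaltsevField w) := by
  ext x
  obtain ⟨α, rfl⟩ := exists_gMap_eq x
  simp [fEquiv_gMap]

theorem fEquiv_comp (w w' w'' : NCPair (Heisenberg F)) :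
    fEquiv w w'' = (fEquiv w' w'').comp (fEquiv w w') := by
  ext x
  obtain ⟨α, rfl⟩ := exists_gMap_eq x
  simp [fEquiv_gMap]

/-- In F_w the commutator of the pair w' is g_w(Δ'/Δ), so multiplying g_w(α) by it gives h(0,0,αΔ')
= g_w'(α). Membership of x in the center comes for free from `maltsevMul_iff`. -/
theorem maltsevMul_comm_iff {w w' : NCPair (Heisenberg F)} {x y : Heisenberg F} :
    MaltsevMul w.1.1 w.1.2 x (comm w'.1.1 w'.1.2) y ↔
      ∃ α, x = (gMap w α).toH ∧ y = (gMap w' α).toH := by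
  have hΔ := w.Delta_ne_zero
  rw [maltsevMul_iff hΔ, comm_eq_hElem]
  simp only [hElem_inj, true_and]
  constructor
  · rintro ⟨α, β, rfl, h, rfl⟩
    exact ⟨α, rfl, by rw [mul_assoc, ← h]; rfl⟩
  · rintro ⟨α, rfl, rfl⟩
    refine ⟨α, Delta w'.1.1 w'.1.2 / Delta w.1.1 w.1.2, rfl, by rw [div_mul_cancel₀ _ hΔ], ?_⟩
    rw [mul_assoc, div_mul_cancel₀ _ hΔ]
    rfl

theorem toH_injective {w : NCPair (Heisenberg F)} :
    Function.Injective (MaltsevField.toH (w := w)) :=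
  Subtype.val_injective

theorem maltsevMul_comm_iff_fEquiv {w w' : NCPair (Heisenberg F)} {x y : Heisenberg F} :
    MaltsevMul w.1.1 w.1.2 x (comm w'.1.1 w'.1.2) y ↔
      ∃ a : MaltsevField w, a.toH = x ∧ (fEquiv w w' a).toH = y := by
  rw [maltsevMul_comm_iff]
  constructor
  · rintro ⟨α, rfl, rfl⟩
    exact ⟨gMap w α, rfl, by rw [fEquiv_gMap]⟩
  · rintro ⟨a, rfl, rfl⟩
    obtain ⟨α, rfl⟩ := exists_gMap_eq a
    exact ⟨α, rfl, by rw [fEquiv_gMap]⟩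

end Algebra

/-! ### Certificates for products -/

section Certificates

variable {X : Type v} (R : X → X → X → Prop)

/-- `p = x y = y x`. -/
def CommutesVia (x y p : X) : Prop := R x y p ∧ R y x p

/-- `[x, y] = z`, as `p = x y`, `q = y x` and `q z = p`. -/
def CommVia (x y z p q : X) : Prop := R x y p ∧ R y x q ∧ R q z p

/-- The values of `f` certify that `z` is the product of `x` and `y` in `F_(u,v)`. -/
def MulVia (u v x y z : X) (f : ℕ → X) : Prop :=
  CommutesVia R (f 0) u (f 2) ∧ CommutesVia R (f 1) v (f 3) ∧
  CommVia R (f 0) v x (f 4) (f 5) ∧ CommVia R u (f 1) y (f 6) (f 7) ∧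
  CommVia R (f 0) (f 1) z (f 8) (f 9)

variable {R} {F : Type u} [Field F]

/-- `R` is the graph of the multiplication of `H(F)`, where `d` gives names to the elements. -/
structure Names (R : X → X → X → Prop) (d : Heisenberg F → X) : Prop where
  inj : Function.Injective d
  iff : ∀ a b c, R a b c ↔ ∃ x y, d x = a ∧ d y = b ∧ d (x * y) = c

namespace Names

variable {d : Heisenberg F → X} (h : Names R d)
include h

theorem mul (x y : Heisenberg F) : R (d x) (d y) (d (x * y)) :=
  (h.iff _ _ _).2 ⟨x, y, rfl, rfl, rfl⟩

theorem eq_of_rel {x y : Heisenberg F} {c : X} (hc : R (d x) (d y) c) : d (x * y) = c := by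
  obtain ⟨x', y', hx, hy, rfl⟩ := (h.iff _ _ _).1 hc
  rw [h.inj hx, h.inj hy]

theorem exists_of_commutesVia {x y p : X} (hp : CommutesVia R x y p) :
    ∃ x' y', d x' = x ∧ d y' = y ∧ comm x' y' = 1 := by
  obtain ⟨x', y', rfl, rfl, hp₁⟩ := (h.iff _ _ _).1 hp.1
  refine ⟨x', y', rfl, rfl, ?_⟩
  rw [comm_eq_iff, mul_one]
  exact h.inj (hp₁.trans (h.eq_of_rel hp.2).symm)

theorem commutesVia {x y : Heisenberg F} (hxy : comm x y = 1) :
    CommutesVia R (d x) (d y) (d (x * y)) := by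
  rw [comm_eq_iff, mul_one] at hxy
  refine ⟨h.mul _ _, ?_⟩
  rw [hxy]
  exact h.mul _ _

theorem exists_of_commVia {x y z p q : X} (hp : CommVia R x y z p q) :
    ∃ x' y', d x' = x ∧ d y' = y ∧ d (comm x' y') = z := by
  obtain ⟨h₁, h₂, h₃⟩ := hp
  obtain ⟨x', y', rfl, rfl, hp₁⟩ := (h.iff _ _ _).1 h₁
  obtain ⟨q', z', rfl, rfl, hp₂⟩ := (h.iff _ _ _).1 h₃
  refine ⟨x', y', rfl, rfl, ?_⟩
  rw [comm_eq_iff.2 ?_]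
  rw [h.inj (h.eq_of_rel h₂)]
  exact h.inj (hp₁.trans hp₂.symm)

theorem commVia (x y : Heisenberg F) :
    CommVia R (d x) (d y) (d (comm x y)) (d (x * y)) (d (y * x)) := by
  refine ⟨h.mul _ _, h.mul _ _, ?_⟩
  rw [comm_eq_iff.1 (rfl : comm x y = _)]
  exact h.mul _ _

theorem exists_of_mulVia {u v : Heisenberg F} {x y z : X} {f : ℕ → X}
    (hf : MulVia R (d u) (d v) x y z f) :
    ∃ x' y' z', d x' = x ∧ d y' = y ∧ d z' = z ∧ MaltsevMul u v x' y' z' := by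
  obtain ⟨h₁, h₂, h₃, h₄, h₅⟩ := hf
  obtain ⟨a, u₁, ha, hu₁, h₁⟩ := h.exists_of_commutesVia h₁
  obtain ⟨b, v₁, hb, hv₁, h₂⟩ := h.exists_of_commutesVia h₂
  obtain ⟨a₁, v₂, ha₁, hv₂, h₃⟩ := h.exists_of_commVia h₃
  obtain ⟨u₂, b₁, hu₂, hb₁, h₄⟩ := h.exists_of_commVia h₄
  obtain ⟨a₂, b₂, ha₂, hb₂, h₅⟩ := h.exists_of_commVia h₅
  obtain rfl := h.inj hu₁
  obtain rfl := h.inj hu₂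
  obtain rfl := h.inj hv₁
  obtain rfl := h.inj hv₂
  obtain rfl := h.inj (ha₁.trans ha.symm)
  obtain rfl := h.inj (ha₂.trans ha.symm)
  obtain rfl := h.inj (hb₁.trans hb.symm)
  obtain rfl := h.inj (hb₂.trans hb.symm)
  exact ⟨_, _, _, h₃, h₄, h₅, _, _, h₁, h₂, rfl, rfl, rfl⟩

theorem exists_mulVia {u v x y z : Heisenberg F} (hm : MaltsevMul u v x y z) :
    ∃ f : ℕ → X, MulVia R (d u) (d v) (d x) (d y) (d z) f := by
  obtain ⟨a, b, h₁, h₂, rfl, rfl, rfl⟩ := hm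
  -- Slots 0 and 1 hold x' and y', slots 2 to 9 the products that `MulVia` asks for; later slots are
  -- never read.
  exact ⟨fun i => d ([a, b, a * u, b * v, a * v, v * a, u * b, b * u, a * b, b * a].getD i 1),
    h.commutesVia h₁, h.commutesVia h₂, h.commVia _ _, h.commVia _ _, h.commVia _ _⟩

end Names

theorem names_heisenberg : Names (X := Heisenberg F) (fun x y z => IsMul x y z) id :=
  ⟨Function.injective_id, fun a b c => by simp [isMul_iff]⟩

end Certificates

/-! ### The defining formula -/

section Formula

open FirstOrder.Language

/-- The atomic formula `x * y = z`, where the free variables are numbered from `0` to `5` and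
the variables to be quantified from `6` on. -/
def mulAtom (i j k : Fin 6 ⊕ Fin 13) : groupLang.BoundedFormula (Fin 6) 13 :=
  mulSymbol.boundedFormula fun l => Term.var (![i, j, k] l)

theorem isQF_mulAtom (i j k : Fin 6 ⊕ Fin 13) : (mulAtom i j k).IsQF :=
  (BoundedFormula.IsAtomic.rel _ _).isQF

theorem realize_mulAtom {G : Type u} [groupLang.Structure G] (a : Fin 6 → G) (f : Fin 13 → G)
    (i j k : Fin 6 ⊕ Fin 13) : (mulAtom i j k).Realize a f ↔
      IsMul (Sum.elim a f i) (Sum.elim a f j) (Sum.elim a f k) := by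
  rw [mulAtom, BoundedFormula.realize_rel, IsMul]
  congr! 1
  funext l
  fin_cases l <;> rfl

/-- A conjunction of atoms. -/
def conjAtoms : List ((Fin 6 ⊕ Fin 13) × (Fin 6 ⊕ Fin 13) × (Fin 6 ⊕ Fin 13)) →
    groupLang.BoundedFormula (Fin 6) 13
  | [] => ⊤
  | t :: l => mulAtom t.1 t.2.1 t.2.2 ⊓ conjAtoms l

theorem isQF_conjAtoms : ∀ l, (conjAtoms l).IsQF
  | [] => BoundedFormula.IsQF.top
  | _ :: l => (isQF_mulAtom _ _ _).inf (isQF_conjAtoms l)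

theorem isExistential_exs {L : FirstOrder.Language.{0, 0}} {α : Type} :
    ∀ {n : ℕ} {φ : L.BoundedFormula α n}, φ.IsExistential → φ.exs.IsExistential
  | 0, _, h => h
  | _ + 1, φ, h => isExistential_exs (φ := φ.ex) h.ex

/-- The formula `∃ e, [u', v'] = e ∧ x ⊗_(u,v) e = y`. -/
def transferFormula : groupLang.Formula (Fin 6) :=
  (conjAtoms [
    -- Bound variable 10 is e = [u',v'], certified by the products in 11 and 12; variables 0 to 9
    -- are numbered as in `MulVia`.
    (.inl 2, .inl 3, .inr 11), (.inl 3, .inl 2, .inr 12), (.inr 12, .inr 10, .inr 11),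
    (.inr 0, .inl 0, .inr 2), (.inl 0, .inr 0, .inr 2),
    (.inr 1, .inl 1, .inr 3), (.inl 1, .inr 1, .inr 3),
    (.inr 0, .inl 1, .inr 4), (.inl 1, .inr 0, .inr 5), (.inr 5, .inl 4, .inr 4),
    (.inl 0, .inr 1, .inr 6), (.inr 1, .inl 0, .inr 7), (.inr 7, .inr 10, .inr 6),
    (.inr 0, .inr 1, .inr 8), (.inr 1, .inr 0, .inr 9), (.inr 9, .inl 5, .inr 8)]).exs

theorem isExistential_transferFormula : transferFormula.IsExistential :=
  isExistential_exs (isQF_conjAtoms _).isExistential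

theorem realize_transferFormula_iff {G : Type u} [groupLang.Structure G] {u v u' v' x y : G} :
    transferFormula.Realize ![u, v, u', v', x, y] ↔ ∃ (f : ℕ → G),
      CommVia IsMul u' v' (f 10) (f 11) (f 12) ∧ MulVia IsMul u v x (f 10) y f := by
  rw [transferFormula, BoundedFormula.realize_exs]
  simp only [conjAtoms, BoundedFormula.realize_inf, realize_mulAtom, BoundedFormula.realize_top,
    Sum.elim_inl, Sum.elim_inr, MulVia, CommVia, CommutesVia, and_assoc, and_true]
  constructor
  · rintro ⟨f, hf⟩
    exact ⟨fun i => if hi : i < 13 then f ⟨i, hi⟩ else f 0, hf⟩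
  · rintro ⟨f, hf⟩
    exact ⟨fun i => f i, hf⟩

theorem realize_transferFormula {F : Type u} [Field F] {u v u' v' x y : Heisenberg F} :
    transferFormula.Realize ![u, v, u', v', x, y] ↔ MaltsevMul u v x (comm u' v') y := by
  have h := names_heisenberg (F := F)
  rw [realize_transferFormula_iff]
  constructor
  · rintro ⟨f, h₁, h₂⟩
    obtain ⟨_, _, rfl, rfl, h₃⟩ := h.exists_of_commVia h₁
    obtain ⟨_, _, _, rfl, h₄, rfl, h₅⟩ := h.exists_of_mulVia (u := u) (v := v) h₂
    rw [← h₃] at h₄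
    obtain rfl := h.inj h₄
    exact h₅
  · intro hm
    obtain ⟨f, hf⟩ := h.exists_mulVia hm
    exact ⟨fun i => if i < 10 then f i else [comm u' v', u' * v', v' * u'].getD (i - 10) 1,
      h.commVia _ _, hf⟩

end Formula

/-! ### Codes of atomic sentences and searches in a diagram -/

section Codes

/-- The code of `a = b` (for `t = 0`) or its negation (for `t = 1`). -/
def eqCode (t a b : ℕ) : ℕ :=
  Nat.pair t (Nat.pair 0 (Nat.pair a b))

/-- The code of a ternary atomic sentence (for `t = 0`) or its negation (for `t = 1`); the relation
symbol has the code `r`. -/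
def relCode (t r a b c : ℕ) : ℕ :=
  Nat.pair t (Nat.pair 1 (Nat.pair 3 (Nat.pair r (encode [a, b, c]))))

/-- The tag of a code: `0` for atomic sentences and `1` for their negations. -/
def codeTag (k : ℕ) : ℕ := k.unpair.1

/-- The left side of a coded equation. -/
def eqLeft (k : ℕ) : ℕ := k.unpair.2.unpair.2.unpair.1

/-- The right side of a coded equation. -/
def eqRight (k : ℕ) : ℕ := k.unpair.2.unpair.2.unpair.2

/-- The code of the relation symbol in a coded sentence. -/
def relSymbol (k : ℕ) : ℕ := k.unpair.2.unpair.2.unpair.2.unpair.1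

/-- The `i`-th entry of the list coded by `w`. -/
def entry (w i : ℕ) : ℕ := (Denumerable.ofNat (List ℕ) w).getD i 0

/-- The `i`-th argument of the relation symbol in a coded sentence. -/
def relArg (k i : ℕ) : ℕ := entry k.unpair.2.unpair.2.unpair.2.unpair.2 i

/-- `k` codes an equation or its negation. -/
def IsEqCode (k : ℕ) : Prop :=
  codeTag k < 2 ∧ k = eqCode (codeTag k) (eqLeft k) (eqRight k)

/-- `k` codes a ternary atomic sentence with relation symbol coded by `0` or `1`, or the negation
of such a sentence. -/
def IsRelCode (k : ℕ) : Prop :=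
  codeTag k < 2 ∧ relSymbol k < 2 ∧
    k = relCode (codeTag k) (relSymbol k) (relArg k 0) (relArg k 1) (relArg k 2)

theorem entry_encode (l : List ℕ) (i : ℕ) : entry (encode l) i = l.getD i 0 := by
  rw [entry, Denumerable.ofNat_encode]

/-- Certificates are functions on ℕ of which only finitely many values matter, so the search may
range over coded lists. -/
theorem exists_entry_eq (f : ℕ → ℕ) (n : ℕ) : ∃ w, ∀ i, i < n → entry w i = f i :=
  ⟨encode ((List.range n).map f), fun i hi => by simp [entry_encode, hi]⟩

theorem isEqCode_iff {k : ℕ} : IsEqCode k ↔ ∃ t a b, t < 2 ∧ k = eqCode t a b := by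
  constructor
  · rintro ⟨h, hk⟩
    exact ⟨_, _, _, h, hk⟩
  · rintro ⟨t, a, b, h, rfl⟩
    simp [IsEqCode, codeTag, eqLeft, eqRight, eqCode, h]

theorem isRelCode_iff {k : ℕ} :
    IsRelCode k ↔ ∃ t r a b c, t < 2 ∧ r < 2 ∧ k = relCode t r a b c := by
  constructor
  · rintro ⟨h, h', hk⟩
    exact ⟨_, _, _, _, _, h, h', hk⟩
  · rintro ⟨t, r, a, b, c, h, h', rfl⟩
    simp only [IsRelCode, codeTag, relSymbol, relArg, relCode, Nat.unpair_pair, entry_encode, h, h',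
      true_and]
    rfl

/-- `a * b = c` according to a diagram. -/
def MulTrue (A : ℕ → ℕ) (a b c : ℕ) : Prop := A (relCode 0 0 a b c) = 1

/-- `a` belongs to the universe according to a diagram. -/
def InUniv (A : ℕ → ℕ) (a : ℕ) : Prop := A (eqCode 0 a a) = 1

/-- `x` commutes with `u` and `v`, with products `p` and `q`. -/
def CentralVia (A : ℕ → ℕ) (u v x p q : ℕ) : Prop :=
  CommutesVia (MulTrue A) x u p ∧ CommutesVia (MulTrue A) x v q

/-- The numbers `p` and `q` suffice to decide whether `x` commutes with `u` and `v`. -/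
def CentralSettled (A : ℕ → ℕ) (u v x p q : ℕ) : Prop :=
  InUniv A x → MulTrue A x u p ∧ MulTrue A x v q

/-- `n` codes a non-commuting pair and its product. -/
def CodesPair (A : ℕ → ℕ) (n : ℕ) : Prop :=
  MulTrue A n.unpair.1 n.unpair.2.unpair.1 n.unpair.2.unpair.2 ∧
    ¬ MulTrue A n.unpair.2.unpair.1 n.unpair.1 n.unpair.2.unpair.2

/-- The values of `f` suffice to decide whether `k` is in the diagram of `F_(u,v)`. -/
def FieldSettled (A : ℕ → ℕ) (u v k : ℕ) (f : ℕ → ℕ) : Prop :=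
  (IsEqCode k → CentralSettled A u v (eqLeft k) (f 10) (f 11) ∧
    CentralSettled A u v (eqRight k) (f 12) (f 13)) ∧
  (IsRelCode k → CentralSettled A u v (relArg k 0) (f 10) (f 11) ∧
    CentralSettled A u v (relArg k 1) (f 12) (f 13) ∧
    CentralSettled A u v (relArg k 2) (f 14) (f 15) ∧
    (CentralVia A u v (relArg k 0) (f 10) (f 11) ∧ CentralVia A u v (relArg k 1) (f 12) (f 13) →
      (relSymbol k = 0 → MulTrue A (relArg k 0) (relArg k 1) (f 16)) ∧
      (relSymbol k = 1 → MulVia (MulTrue A) u v (relArg k 0) (relArg k 1) (f 16) f)))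

/-- `k` is in the diagram of `F_(u,v)`, as decided with the values of `f`. -/
def FieldValue (A : ℕ → ℕ) (u v k : ℕ) (f : ℕ → ℕ) : Prop :=
  (IsEqCode k ∧ CentralVia A u v (eqLeft k) (f 10) (f 11) ∧
    CentralVia A u v (eqRight k) (f 12) (f 13) ∧
    (codeTag k = 0 ∧ eqLeft k = eqRight k ∨ ¬ codeTag k = 0 ∧ ¬ eqLeft k = eqRight k)) ∨
  (IsRelCode k ∧ CentralVia A u v (relArg k 0) (f 10) (f 11) ∧
    CentralVia A u v (relArg k 1) (f 12) (f 13) ∧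
    CentralVia A u v (relArg k 2) (f 14) (f 15) ∧
    (codeTag k = 0 ∧ f 16 = relArg k 2 ∨ ¬ codeTag k = 0 ∧ ¬ f 16 = relArg k 2))

/-- The values of `f` suffice to find the image of `x` under the composition of the map with
graph `P` and the transfer from `F_(P u₁, P v₁)` to `F_(u₂,v₂)`. -/
def MapSettled (A P B : ℕ → ℕ) (u₁ v₁ u₂ v₂ x : ℕ) (f : ℕ → ℕ) : Prop :=
  CentralSettled A u₁ v₁ x (f 13) (f 14) ∧
  (CentralVia A u₁ v₁ x (f 13) (f 14) →
    P (Nat.pair u₁ (f 15)) = 1 ∧ P (Nat.pair v₁ (f 16)) = 1 ∧ P (Nat.pair x (f 17)) = 1 ∧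
    CommVia (MulTrue B) u₂ v₂ (f 10) (f 11) (f 12) ∧
    MulVia (MulTrue B) (f 15) (f 16) (f 17) (f 10) (f 18) f)

/-- `y` is the image found with the values of `f`. -/
def MapValue (A : ℕ → ℕ) (u₁ v₁ x y : ℕ) (f : ℕ → ℕ) : Prop :=
  CentralVia A u₁ v₁ x (f 13) (f 14) ∧ f 18 = y

end Codes

/-! ### Decidability of the certificate conditions, and the three programs -/

section Decidability

variable {α : Type} [Primcodable α] {f f₁ f₂ f₃ f₄ f₅ : α → ℕ} {g : ℕ → ℕ} {h : α → ℕ → ℕ}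

theorem primrec_unpair_fst (hf : Primrec f) : Primrec fun a => (f a).unpair.1 :=
  Primrec.fst.comp (Primrec.unpair.comp hf)

theorem primrec_unpair_snd (hf : Primrec f) : Primrec fun a => (f a).unpair.2 :=
  Primrec.snd.comp (Primrec.unpair.comp hf)

theorem primrec_pair (h₁ : Primrec f₁) (h₂ : Primrec f₂) :
    Primrec fun a => Nat.pair (f₁ a) (f₂ a) :=
  Primrec₂.natPair.comp h₁ h₂

theorem primrec_entry (hf : Primrec f) (i : ℕ) : Primrec fun a => entry (f a) i :=
  (Primrec.list_getD 0).comp ((Primrec.ofNat (List ℕ)).comp hf) (Primrec.const i)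

theorem primrec_eqCode (h₁ : Primrec f₁) (h₂ : Primrec f₂) (h₃ : Primrec f₃) :
    Primrec fun a => eqCode (f₁ a) (f₂ a) (f₃ a) :=
  primrec_pair h₁ (primrec_pair (Primrec.const 0) (primrec_pair h₂ h₃))

theorem primrec_relCode (h₁ : Primrec f₁) (h₂ : Primrec f₂) (h₃ : Primrec f₃) (h₄ : Primrec f₄)
    (h₅ : Primrec f₅) : Primrec fun a => relCode (f₁ a) (f₂ a) (f₃ a) (f₄ a) (f₅ a) :=
  primrec_pair h₁ (primrec_pair (Primrec.const 1) (primrec_pair (Primrec.const 3)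
    (primrec_pair h₂ (Primrec.encode.comp (Primrec.list_cons.comp h₃
      (Primrec.list_cons.comp h₄ (Primrec.list_cons.comp h₅ (Primrec.const []))))))))

theorem primrec_codeTag (hf : Primrec f) : Primrec fun a => codeTag (f a) :=
  primrec_unpair_fst hf

theorem primrec_eqLeft (hf : Primrec f) : Primrec fun a => eqLeft (f a) :=
  primrec_unpair_fst (primrec_unpair_snd (primrec_unpair_snd hf))

theorem primrec_eqRight (hf : Primrec f) : Primrec fun a => eqRight (f a) :=
  primrec_unpair_snd (primrec_unpair_snd (primrec_unpair_snd hf))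

theorem primrec_relSymbol (hf : Primrec f) : Primrec fun a => relSymbol (f a) :=
  primrec_unpair_fst (primrec_unpair_snd (primrec_unpair_snd (primrec_unpair_snd hf)))

theorem primrec_relArg (hf : Primrec f) (i : ℕ) : Primrec fun a => relArg (f a) i :=
  primrec_entry
    (primrec_unpair_snd (primrec_unpair_snd (primrec_unpair_snd (primrec_unpair_snd hf)))) i

namespace OracleDecidable

theorem lt_two (hf : Primrec f) : OracleDecidable fun _ a => f a < 2 :=
  of_primrecPred (Primrec.nat_lt.comp hf (Primrec.const 2))

theorem isEqCode (hf : Primrec f) : OracleDecidable fun _ a => IsEqCode (f a) :=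
  (lt_two (primrec_codeTag hf)).and
    (eq_nat hf (primrec_eqCode (primrec_codeTag hf) (primrec_eqLeft hf) (primrec_eqRight hf)))

theorem isRelCode (hf : Primrec f) : OracleDecidable fun _ a => IsRelCode (f a) :=
  (lt_two (primrec_codeTag hf)).and ((lt_two (primrec_relSymbol hf)).and
    (eq_nat hf (primrec_relCode (primrec_codeTag hf) (primrec_relSymbol hf)
      (primrec_relArg hf 0) (primrec_relArg hf 1) (primrec_relArg hf 2))))

/-- The reindexing g lets the same statement serve a whole oracle (g the identity) and a component
of a join (g n = 3n + i). -/
theorem mulTrue (hg : Primrec g) (h₁ : Primrec f₁) (h₂ : Primrec f₂) (h₃ : Primrec f₃) :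
    OracleDecidable fun A a => MulTrue (fun n => A (g n)) (f₁ a) (f₂ a) (f₃ a) :=
  query (hg.comp (primrec_relCode (Primrec.const 0) (Primrec.const 0) h₁ h₂ h₃))

theorem commutesVia (hg : Primrec g) (h₁ : Primrec f₁) (h₂ : Primrec f₂) (h₃ : Primrec f₃) :
    OracleDecidable fun A a => CommutesVia (MulTrue fun n => A (g n)) (f₁ a) (f₂ a) (f₃ a) :=
  (mulTrue hg h₁ h₂ h₃).and (mulTrue hg h₂ h₁ h₃)

theorem commVia (hg : Primrec g) (h₁ : Primrec f₁) (h₂ : Primrec f₂) (h₃ : Primrec f₃)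
    (h₄ : Primrec f₄) (h₅ : Primrec f₅) : OracleDecidable fun A a =>
      CommVia (MulTrue fun n => A (g n)) (f₁ a) (f₂ a) (f₃ a) (f₄ a) (f₅ a) :=
  (mulTrue hg h₁ h₂ h₄).and ((mulTrue hg h₂ h₁ h₅).and (mulTrue hg h₅ h₃ h₄))

theorem mulVia (hg : Primrec g) (h₁ : Primrec f₁) (h₂ : Primrec f₂) (h₃ : Primrec f₃)
    (h₄ : Primrec f₄) (h₅ : Primrec f₅) (hh : ∀ i, Primrec fun a => h a i) :
    OracleDecidable fun A a =>
      MulVia (MulTrue fun n => A (g n)) (f₁ a) (f₂ a) (f₃ a) (f₄ a) (f₅ a) (h a) :=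
  (commutesVia hg (hh 0) h₁ (hh 2)).and <| (commutesVia hg (hh 1) h₂ (hh 3)).and <|
    (commVia hg (hh 0) h₂ h₃ (hh 4) (hh 5)).and <| (commVia hg h₁ (hh 1) h₄ (hh 6) (hh 7)).and <|
    commVia hg (hh 0) (hh 1) h₅ (hh 8) (hh 9)

theorem centralVia (hg : Primrec g) (h₁ : Primrec f₁) (h₂ : Primrec f₂) (h₃ : Primrec f₃)
    (h₄ : Primrec f₄) (h₅ : Primrec f₅) : OracleDecidable fun A a =>
      CentralVia (fun n => A (g n)) (f₁ a) (f₂ a) (f₃ a) (f₄ a) (f₅ a) :=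
  (commutesVia hg h₃ h₁ h₄).and (commutesVia hg h₃ h₂ h₅)

theorem centralSettled (hg : Primrec g) (h₁ : Primrec f₁) (h₂ : Primrec f₂) (h₃ : Primrec f₃)
    (h₄ : Primrec f₄) (h₅ : Primrec f₅) : OracleDecidable fun A a =>
      CentralSettled (fun n => A (g n)) (f₁ a) (f₂ a) (f₃ a) (f₄ a) (f₅ a) :=
  (query (hg.comp (primrec_eqCode (Primrec.const 0) h₃ h₃))).imp
    ((mulTrue hg h₃ h₁ h₄).and (mulTrue hg h₃ h₂ h₅))

theorem fieldSettled (h₁ : Primrec f₁) (h₂ : Primrec f₂) (h₃ : Primrec f₃)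
    (hh : ∀ i, Primrec fun a => h a i) :
    OracleDecidable fun A a => FieldSettled A (f₁ a) (f₂ a) (f₃ a) (h a) :=
  ((isEqCode h₃).imp ((centralSettled .id h₁ h₂ (primrec_eqLeft h₃) (hh 10) (hh 11)).and
    (centralSettled .id h₁ h₂ (primrec_eqRight h₃) (hh 12) (hh 13)))).and <|
  (isRelCode h₃).imp <|
    (centralSettled .id h₁ h₂ (primrec_relArg h₃ 0) (hh 10) (hh 11)).and <|
    (centralSettled .id h₁ h₂ (primrec_relArg h₃ 1) (hh 12) (hh 13)).and <|
    (centralSettled .id h₁ h₂ (primrec_relArg h₃ 2) (hh 14) (hh 15)).and <|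
    ((centralVia .id h₁ h₂ (primrec_relArg h₃ 0) (hh 10) (hh 11)).and
      (centralVia .id h₁ h₂ (primrec_relArg h₃ 1) (hh 12) (hh 13))).imp <|
    ((eq_nat (primrec_relSymbol h₃) (.const 0)).imp
      (mulTrue .id (primrec_relArg h₃ 0) (primrec_relArg h₃ 1) (hh 16))).and
    ((eq_nat (primrec_relSymbol h₃) (.const 1)).imp
      (mulVia .id h₁ h₂ (primrec_relArg h₃ 0) (primrec_relArg h₃ 1) (hh 16) hh))

theorem fieldValue (h₁ : Primrec f₁) (h₂ : Primrec f₂) (h₃ : Primrec f₃)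
    (hh : ∀ i, Primrec fun a => h a i) :
    OracleDecidable fun A a => FieldValue A (f₁ a) (f₂ a) (f₃ a) (h a) := by
  have ht := eq_nat (primrec_codeTag h₃) (Primrec.const 0)
  have he := eq_nat (primrec_eqLeft h₃) (primrec_eqRight h₃)
  have hr := eq_nat (hh 16) (primrec_relArg h₃ 2)
  exact ((isEqCode h₃).and <|
    (centralVia .id h₁ h₂ (primrec_eqLeft h₃) (hh 10) (hh 11)).and <|
    (centralVia .id h₁ h₂ (primrec_eqRight h₃) (hh 12) (hh 13)).and <|
    (ht.and he).or (ht.not.and he.not)).or <|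
  (isRelCode h₃).and <|
    (centralVia .id h₁ h₂ (primrec_relArg h₃ 0) (hh 10) (hh 11)).and <|
    (centralVia .id h₁ h₂ (primrec_relArg h₃ 1) (hh 12) (hh 13)).and <|
    (centralVia .id h₁ h₂ (primrec_relArg h₃ 2) (hh 14) (hh 15)).and <|
    (ht.and hr).or (ht.not.and hr.not)

end OracleDecidable

theorem primrec_mul_add (i : ℕ) : Primrec fun n => 3 * n + i :=
  Primrec.nat_add.comp (Primrec.nat_mul.comp (Primrec.const 3) Primrec.id) (Primrec.const i)

namespace OracleDecidable

theorem mapSettled {f₁ f₂ f₃ f₄ f₅ : α → ℕ} (h₁ : Primrec f₁) (h₂ : Primrec f₂) (h₃ : Primrec f₃)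
    (h₄ : Primrec f₄) (h₅ : Primrec f₅) (hh : ∀ i, Primrec fun a => h a i) :
    OracleDecidable fun A a => MapSettled (fun n => A (3 * n + 0)) (fun n => A (3 * n + 1))
      (fun n => A (3 * n + 2)) (f₁ a) (f₂ a) (f₃ a) (f₄ a) (f₅ a) (h a) :=
  (centralSettled (primrec_mul_add 0) h₁ h₂ h₅ (hh 13) (hh 14)).and <|
  (centralVia (primrec_mul_add 0) h₁ h₂ h₅ (hh 13) (hh 14)).imp <|
    (query ((primrec_mul_add 1).comp (primrec_pair h₁ (hh 15)))).and <|
    (query ((primrec_mul_add 1).comp (primrec_pair h₂ (hh 16)))).and <|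
    (query ((primrec_mul_add 1).comp (primrec_pair h₅ (hh 17)))).and <|
    (commVia (primrec_mul_add 2) h₃ h₄ (hh 10) (hh 11) (hh 12)).and
      (mulVia (primrec_mul_add 2) (hh 15) (hh 16) (hh 17) (hh 10) (hh 18) hh)

theorem mapValue (h₁ : Primrec f₁) (h₂ : Primrec f₂) (h₃ : Primrec f₃) (h₄ : Primrec f₄)
    (hh : ∀ i, Primrec fun a => h a i) :
    OracleDecidable fun A a =>
      MapValue (fun n => A (3 * n + 0)) (f₁ a) (f₂ a) (f₃ a) (f₄ a) (h a) :=
  (centralVia (primrec_mul_add 0) h₁ h₂ h₃ (hh 13) (hh 14)).and (eq_nat (hh 18) h₄)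

end OracleDecidable

open TuringOperator

/-- A program that finds a non-commuting pair. -/
theorem exists_pairOperator : ∃ c : TuringOperator, ∀ A, (∃ n, CodesPair A n) →
    ∃ n, CodesPair A n ∧ c.eval A 0 = Part.some n := by
  have hn : Primrec fun a : ℕ × ℕ => a.2 := Primrec.snd
  have h : OracleDecidable fun A (a : ℕ × ℕ) => CodesPair A a.2 :=
    (OracleDecidable.mulTrue .id (primrec_unpair_fst hn)
      (primrec_unpair_fst (primrec_unpair_snd hn)) (primrec_unpair_snd (primrec_unpair_snd hn))).and
    (OracleDecidable.mulTrue .id (primrec_unpair_fst (primrec_unpair_snd hn))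
      (primrec_unpair_fst hn) (primrec_unpair_snd (primrec_unpair_snd hn))).not
  obtain ⟨c, hc⟩ := h.exists_search
  exact ⟨c, fun A hA => hc A 0 hA⟩

/-- A program that decides the diagram of `F_(u,v)`, for the pair `(u,v)` found by `c`. -/
theorem exists_fieldOperator (c : TuringOperator) : ∃ Φ : TuringOperator, ∀ A n,
    c.eval A 0 = Part.some n → ∀ k r,
    (∃ f, FieldSettled A n.unpair.1 n.unpair.2.unpair.1 k f) →
    (∀ f, FieldSettled A n.unpair.1 n.unpair.2.unpair.1 k f →
      (FieldValue A n.unpair.1 n.unpair.2.unpair.1 k f ∧ r = 1) ∨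
      (¬ FieldValue A n.unpair.1 n.unpair.2.unpair.1 k f ∧ r = 0)) →
    Φ.eval A k = Part.some r := by
  have hk : Primrec fun a : (ℕ × ℕ) × ℕ => a.1.1 := Primrec.fst.comp Primrec.fst
  have hn : Primrec fun a : (ℕ × ℕ) × ℕ => a.1.2 := Primrec.snd.comp Primrec.fst
  have hf := fun i => primrec_entry (Primrec.snd (α := ℕ × ℕ) (β := ℕ)) i
  obtain ⟨d, hd⟩ := OracleDecidable.exists_search_decide
    (.fieldSettled (primrec_unpair_fst hn) (primrec_unpair_fst (primrec_unpair_snd hn)) hk hf)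
    (.fieldValue (primrec_unpair_fst hn) (primrec_unpair_fst (primrec_unpair_snd hn)) hk hf)
  refine ⟨d.comp ((left.pair right).pair (c.comp zero)), fun A n hn k r hS hV => ?_⟩
  have hid : (left.pair right).eval A k = Part.some k := by
    rw [eval_pair_some (a := k.unpair.1) (b := k.unpair.2) rfl rfl, Nat.pair_unpair]
  rw [eval_comp_some (eval_pair_some hid ((eval_comp_some rfl).trans hn))]
  refine hd A (k, n) ?_ r fun w hw => hV _ hw
  obtain ⟨f, hf⟩ := hS
  -- `FieldSettled` reads only slots 0 to 16.
  obtain ⟨w, hw⟩ := exists_entry_eq f 17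
  refine ⟨w, ?_⟩
  simpa only [FieldSettled, MulVia, CommVia, CommutesVia, hw, Nat.reduceLT] using hf

/-- A program that decides the graph of an isomorphism between the fields, for the pairs found
by `c`. -/
theorem exists_mapOperator (c : TuringOperator) : ∃ Ψ : TuringOperator, ∀ A P B n m,
    c.eval A 0 = Part.some n → c.eval B 0 = Part.some m → ∀ x y r,
    (∃ f, MapSettled A P B n.unpair.1 n.unpair.2.unpair.1 m.unpair.1 m.unpair.2.unpair.1 x f) →
    (∀ f,
      MapSettled A P B n.unpair.1 n.unpair.2.unpair.1 m.unpair.1 m.unpair.2.unpair.1 x f →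
      (MapValue A n.unpair.1 n.unpair.2.unpair.1 x y f ∧ r = 1) ∨
      (¬ MapValue A n.unpair.1 n.unpair.2.unpair.1 x y f ∧ r = 0)) →
    Ψ.eval (join₃ A P B) (Nat.pair x y) = Part.some r := by
  have hk : Primrec fun a : (ℕ × ℕ × ℕ) × ℕ => a.1.1 := Primrec.fst.comp Primrec.fst
  have hn : Primrec fun a : (ℕ × ℕ × ℕ) × ℕ => a.1.2.1 :=
    Primrec.fst.comp (Primrec.snd.comp Primrec.fst)
  have hm : Primrec fun a : (ℕ × ℕ × ℕ) × ℕ => a.1.2.2 :=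
    Primrec.snd.comp (Primrec.snd.comp Primrec.fst)
  have hf := fun i => primrec_entry (Primrec.snd (α := ℕ × ℕ × ℕ) (β := ℕ)) i
  obtain ⟨d, hd⟩ := OracleDecidable.exists_search_decide
    (.mapSettled (primrec_unpair_fst hn) (primrec_unpair_fst (primrec_unpair_snd hn))
      (primrec_unpair_fst hm) (primrec_unpair_fst (primrec_unpair_snd hm))
      (primrec_unpair_fst hk) hf)
    (.mapValue (primrec_unpair_fst hn) (primrec_unpair_fst (primrec_unpair_snd hn))
      (primrec_unpair_fst hk) (primrec_unpair_snd hk) hf)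
  obtain ⟨s, hs⟩ := (primrec_mul_add 0).to_comp.oracleComputable
  obtain ⟨t, ht⟩ := (primrec_mul_add 2).to_comp.oracleComputable
  refine ⟨d.comp ((left.pair right).pair (((precompOracle s c).comp zero).pair
    ((precompOracle t c).comp zero))), fun A P B n m hn hm x y r hS hV => ?_⟩
  have hA : (fun n => join₃ A P B (3 * n + 0)) = A := by
    funext n; simp [join₃]
  have hP : (fun n => join₃ A P B (3 * n + 1)) = P := by
    funext n
    simp only [join₃]
    rw [if_neg (by omega), if_pos (by omega)]
    congr 1; omega
  have hB : (fun n => join₃ A P B (3 * n + 2)) = B := by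
    funext n
    simp only [join₃]
    rw [if_neg (by omega), if_neg (by omega)]
    congr 1; omega
  have hid : (left.pair right).eval (join₃ A P B) (Nat.pair x y) = Part.some (Nat.pair x y) := by
    rw [eval_pair_some (a := x) (b := y) (by simp [eval]) (by simp [eval])]
  have hn' : (precompOracle s c).eval (join₃ A P B) 0 = Part.some n := by
    rw [eval_precompOracle (g := fun n => 3 * n + 0) (hs _), hA, hn]
  have hm' : (precompOracle t c).eval (join₃ A P B) 0 = Part.some m := by
    rw [eval_precompOracle (g := fun n => 3 * n + 2) (ht _), hB, hm]
  rw [eval_comp_some (eval_pair_some hid (eval_pair_some ((eval_comp_some rfl).trans hn')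
    ((eval_comp_some rfl).trans hm')))]
  have key := hd (join₃ A P B) (Nat.pair x y, n, m)
  simp only [hA, hP, hB, Nat.unpair_pair] at key
  refine key ?_ r fun w hw => hV _ hw
  obtain ⟨f, hf⟩ := hS
  -- `MapSettled` reads only slots 0 to 18.
  obtain ⟨w, hw⟩ := exists_entry_eq f 19
  refine ⟨w, ?_⟩
  simpa only [MapSettled, MulVia, CommVia, CommutesVia, hw, Nat.reduceLT] using hf

end Decidability
/-! ### Diagrams and names -/

section Diagram

variable {L : FirstOrder.Language.{0, 0}}

theorem charFun_eq_one_iff {S : Set ℕ} {k : ℕ} : charFun S k = 1 ↔ k ∈ S := by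
  by_cases h : k ∈ S <;> simp [charFun, h]

theorem charFun_eq_zero_iff {S : Set ℕ} {k : ℕ} : charFun S k = 0 ↔ k ∉ S := by
  by_cases h : k ∈ S <;> simp [charFun, h]

theorem charFun_injective : Function.Injective charFun := fun S T h => by
  ext k
  rw [← charFun_eq_one_iff, h, charFun_eq_one_iff]

theorem mem_graphCode_iff {X Y : Set ℕ} {p : X → Y} {x : X} {b : ℕ} :
    Nat.pair x b ∈ graphCode p ↔ (p x : ℕ) = b := by
  constructor
  · rintro ⟨y, hy⟩
    rw [Nat.pair_eq_pair] at hy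
    obtain rfl := Subtype.ext hy.1
    exact hy.2.symm
  · rintro rfl
    exact ⟨x, rfl⟩

theorem eqCode_eq [∀ n, Encodable (L.Relations n)] (t a b : ℕ) :
    eqCode t a b = Nat.pair t (AtomicSentence.eq (L := L) a b).godel := rfl

theorem AtomicSentence.godel_injective [∀ n, Encodable (L.Relations n)] :
    Function.Injective (AtomicSentence.godel (L := L)) := by
  rintro (⟨a, b⟩ | @⟨n, R, a⟩) (⟨a', b'⟩ | @⟨n', R', a'⟩) h
  · simp only [godel, Nat.pair_eq_pair] at h
    rw [h.2.1, h.2.2]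
  · simp [godel, Nat.pair_eq_pair] at h
  · simp [godel, Nat.pair_eq_pair] at h
  · simp only [godel, Nat.pair_eq_pair] at h
    obtain ⟨-, rfl, hR, ha⟩ := h
    rw [encode_injective hR, List.ofFn_injective (encode_injective ha)]

section Naming

variable {M : OmegaStructure L} {B : Type u} [L.Structure B]

theorem mem_univ_iff (e : B ≃[L] M.univ) {a : ℕ} : a ∈ M.univ ↔ ∃ x, (e x : ℕ) = a :=
  ⟨fun h => ⟨e.symm ⟨a, h⟩, by simp⟩, by rintro ⟨x, rfl⟩; exact (e x).2⟩

theorem trueIn_rel_iff (e : B ≃[L] M.univ) {n : ℕ} {R : L.Relations n} {x : Fin n → B} :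
    (AtomicSentence.rel R fun i => (e (x i) : ℕ)).TrueIn M ↔
      FirstOrder.Language.Structure.RelMap R x := by
  rw [← e.map_rel]
  exact ⟨fun ⟨_, h⟩ => h, fun h => ⟨fun i => (e (x i)).2, h⟩⟩

/-- The structure on the range of an injective function that is isomorphic to its domain. -/
noncomputable def imageStructure (d : B → ℕ) (hd : Function.Injective d) : OmegaStructure L :=
  ⟨Set.range d, (Equiv.ofInjective d hd).inducedStructure⟩

/-- The isomorphism onto the image structure. -/
noncomputable def imageEquiv (d : B → ℕ) (hd : Function.Injective d) :
    B ≃[L] (imageStructure (L := L) d hd).univ :=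
  (Equiv.ofInjective d hd).inducedStructureEquiv

end Naming

variable [L.IsRelational] [∀ n, Encodable (L.Relations n)] {M : OmegaStructure L}

theorem pair_zero_mem_atomicDiagram {φ : AtomicSentence L} :
    Nat.pair 0 φ.godel ∈ atomicDiagram M ↔ φ.TrueIn M := by
  constructor
  · rintro ⟨χ, ⟨hχ, h⟩ | ⟨-, -, h⟩⟩
    · rw [Nat.pair_eq_pair] at h
      rwa [AtomicSentence.godel_injective h.2]
    · simp [Nat.pair_eq_pair] at h
  · exact fun h => ⟨φ, .inl ⟨h, rfl⟩⟩

theorem pair_one_mem_atomicDiagram {φ : AtomicSentence L} :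
    Nat.pair 1 φ.godel ∈ atomicDiagram M ↔ φ.NamesIn M ∧ ¬ φ.TrueIn M := by
  constructor
  · rintro ⟨χ, ⟨-, h⟩ | ⟨hχ, hχ', h⟩⟩
    · simp [Nat.pair_eq_pair] at h
    · rw [Nat.pair_eq_pair] at h
      rw [AtomicSentence.godel_injective h.2]
      exact ⟨hχ, hχ'⟩
  · exact fun h => ⟨φ, .inr ⟨h.1, h.2, rfl⟩⟩

/-- The sentences a = a recover the universe and the relational atomic sentences recover the
relations; there are no function symbols. Thus an output of Φ determines the structure it codes. -/
theorem structureCode_injective : Function.Injective (structureCode (L := L)) := by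
  intro M N h
  have hT : ∀ φ : AtomicSentence L, φ.TrueIn M ↔ φ.TrueIn N := fun φ => by
    rw [← pair_zero_mem_atomicDiagram, charFun_injective h, pair_zero_mem_atomicDiagram]
  obtain ⟨X, S⟩ := M
  obtain ⟨Y, T⟩ := N
  obtain rfl : X = Y := by
    ext a
    simpa [AtomicSentence.TrueIn] using hT (.eq a a)
  congr 1
  refine FirstOrder.Language.Structure.ext ?_ ?_
  · funext n f
    exact isEmptyElim f
  · funext n R x
    have := hT (.rel R fun i => x i)
    simp only [AtomicSentence.TrueIn, Subtype.coe_prop, implies_true, Subtype.coe_eta,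
      exists_true_left] at this
    exact propext this

theorem eqCode_mem_atomicDiagram {B : Type u} [L.Structure B] (e : B ≃[L] M.univ) {t a b : ℕ}
    (ht : t < 2) : eqCode t a b ∈ atomicDiagram M ↔ (∃ x, (e x : ℕ) = a) ∧ (∃ x, (e x : ℕ) = b) ∧
      (t = 0 ∧ a = b ∨ ¬ t = 0 ∧ ¬ a = b) := by
  rw [← mem_univ_iff e, ← mem_univ_iff e, eqCode_eq (L := L)]
  interval_cases t
  · rw [pair_zero_mem_atomicDiagram]
    simp [AtomicSentence.TrueIn]
  · rw [pair_one_mem_atomicDiagram]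
    simp only [AtomicSentence.TrueIn, AtomicSentence.NamesIn]
    tauto

end Diagram

/-- The relation symbol for fields with code `r`. -/
def fieldSymbol : ℕ → fieldLang.Relations 3
  | 0 => FieldRel.add
  | _ + 1 => FieldRel.mul

theorem relCode_eq_field {r : ℕ} (hr : r < 2) (t a b c : ℕ) :
    relCode t r a b c = Nat.pair t (AtomicSentence.rel (fieldSymbol r) ![a, b, c]).godel := by
  interval_cases r <;> rfl

theorem relCode_eq_group (t a b c : ℕ) :
    relCode t 0 a b c = Nat.pair t (AtomicSentence.rel mulSymbol ![a, b, c]).godel :=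
  rfl

/-- Both field symbols are ternary, so any number of another shape can be rejected outright. -/
theorem mem_fieldDiagram_cases {K : OmegaStructure fieldLang} {k : ℕ} (h : k ∈ atomicDiagram K) :
    IsEqCode k ∨ IsRelCode k := by
  rw [isEqCode_iff, isRelCode_iff]
  obtain ⟨φ, hφ⟩ := h
  obtain ⟨t, ht, rfl⟩ : ∃ t < 2, k = Nat.pair t φ.godel := by
    rcases hφ with ⟨-, h⟩ | ⟨-, -, h⟩
    exacts [⟨0, by simp, h⟩, ⟨1, by simp, h⟩]
  rcases φ with ⟨a, b⟩ | ⟨R, a⟩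
  · exact .inl ⟨t, a, b, ht, rfl⟩
  · right
    cases R with
    | add => exact ⟨t, 0, a 0, a 1, a 2, ht, by simp, rfl⟩
    | mul => exact ⟨t, 1, a 0, a 1, a 2, ht, by simp, rfl⟩

theorem not_isRelCode {k : ℕ} (h : IsEqCode k) : ¬ IsRelCode k := by
  rw [isEqCode_iff] at h
  rw [isRelCode_iff]
  obtain ⟨t, a, b, -, rfl⟩ := h
  rintro ⟨t', r, a', b', c', -, -, h⟩
  simp [eqCode, relCode, Nat.pair_eq_pair] at h

/-! ### The diagram of a copy of a field -/

section FieldDiagram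

variable {F : Type u} [Field F] {K : OmegaStructure fieldLang}

/-- The operation with code `r`. -/
def fieldOp : ℕ → F → F → F
  | 0, x, y => x + y
  | _ + 1, x, y => x * y

theorem relMap_fieldSymbol {r : ℕ} {x : Fin 3 → F} :
    FirstOrder.Language.Structure.RelMap (fieldSymbol r) x ↔ fieldOp r (x 0) (x 1) = x 2 := by
  cases r <;> rfl

theorem relCode_mem_atomicDiagram (e : F ≃[fieldLang] K.univ) {t r a b c : ℕ} (ht : t < 2)
    (hr : r < 2) : relCode t r a b c ∈ atomicDiagram K ↔
      ∃ x y z : F, (e x : ℕ) = a ∧ (e y : ℕ) = b ∧ (e z : ℕ) = c ∧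
        (t = 0 ∧ fieldOp r x y = z ∨ ¬ t = 0 ∧ ¬ fieldOp r x y = z) := by
  have key : ∀ x y z : F, (AtomicSentence.rel (fieldSymbol r)
      ![(e x : ℕ), (e y : ℕ), (e z : ℕ)]).TrueIn K ↔ fieldOp r x y = z := by
    intro x y z
    have h := trueIn_rel_iff e (R := fieldSymbol r) (x := ![x, y, z])
    rw [relMap_fieldSymbol] at h
    rw [← show (fun i => (e (![x, y, z] i) : ℕ)) = ![(e x : ℕ), (e y : ℕ), (e z : ℕ)] by
      funext i; fin_cases i <;> rfl]
    exact h
  have names : (AtomicSentence.rel (fieldSymbol r) ![a, b, c]).NamesIn K ↔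
      ∃ x y z : F, (e x : ℕ) = a ∧ (e y : ℕ) = b ∧ (e z : ℕ) = c := by
    simp only [AtomicSentence.NamesIn, mem_univ_iff e, Fin.forall_fin_succ, IsEmpty.forall_iff]
    constructor
    · rintro ⟨⟨x, hx⟩, ⟨y, hy⟩, ⟨z, hz⟩, -⟩
      exact ⟨x, y, z, hx, hy, hz⟩
    · rintro ⟨x, y, z, hx, hy, hz⟩
      exact ⟨⟨x, hx⟩, ⟨y, hy⟩, ⟨z, hz⟩, trivial⟩
  have names_of_true : (AtomicSentence.rel (fieldSymbol r) ![a, b, c]).TrueIn K →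
      (AtomicSentence.rel (fieldSymbol r) ![a, b, c]).NamesIn K := fun ⟨h, _⟩ => h
  rw [relCode_eq_field hr]
  interval_cases t
  · rw [pair_zero_mem_atomicDiagram]
    constructor
    · intro h
      obtain ⟨x, y, z, rfl, rfl, rfl⟩ := names.1 (names_of_true h)
      exact ⟨x, y, z, rfl, rfl, rfl, .inl ⟨rfl, (key x y z).1 h⟩⟩
    · rintro ⟨x, y, z, rfl, rfl, rfl, ⟨-, h⟩ | ⟨h, -⟩⟩
      · exact (key x y z).2 h
      · exact absurd rfl h
  · rw [pair_one_mem_atomicDiagram]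
    constructor
    · rintro ⟨h, h'⟩
      obtain ⟨x, y, z, rfl, rfl, rfl⟩ := names.1 h
      exact ⟨x, y, z, rfl, rfl, rfl, .inr ⟨one_ne_zero, fun hz => h' ((key x y z).2 hz)⟩⟩
    · rintro ⟨x, y, z, rfl, rfl, rfl, ⟨h, -⟩ | ⟨-, h⟩⟩
      · exact absurd h one_ne_zero
      · exact ⟨names.2 ⟨x, y, z, rfl, rfl, rfl⟩, fun hz => h ((key x y z).1 hz)⟩

end FieldDiagram

/-! ### The diagram of a copy of the Heisenberg group -/

section GroupDiagram

variable {F : Type u} [Field F] {G : OmegaStructure groupLang}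

/-- The element of `G` that an isomorphism takes to `x`, as a number. -/
def nameMap (θ : G.univ ≃[groupLang] Heisenberg F) (x : Heisenberg F) : ℕ := θ.symm x

theorem names_structureCode (θ : G.univ ≃[groupLang] Heisenberg F) :
    Names (MulTrue (structureCode G)) (nameMap θ) := by
  refine ⟨fun x y h => θ.symm.injective (Subtype.ext h), fun a b c => ?_⟩
  rw [MulTrue, structureCode, charFun_eq_one_iff, relCode_eq_group, pair_zero_mem_atomicDiagram]
  have key : ∀ x y z : Heisenberg F, (AtomicSentence.rel mulSymbol
      ![nameMap θ x, nameMap θ y, nameMap θ z]).TrueIn G ↔ x * y = z := by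
    intro x y z
    have h := trueIn_rel_iff θ.symm (R := mulSymbol) (x := ![x, y, z])
    rw [← show (fun i => (θ.symm (![x, y, z] i) : ℕ)) = ![nameMap θ x, nameMap θ y, nameMap θ z] by
      funext i; fin_cases i <;> rfl]
    exact h
  constructor
  · intro h
    obtain ⟨x, hx⟩ := (mem_univ_iff θ.symm).1 (h.1 0)
    obtain ⟨y, hy⟩ := (mem_univ_iff θ.symm).1 (h.1 1)
    obtain ⟨z, hz⟩ := (mem_univ_iff θ.symm).1 (h.1 2)
    change nameMap θ x = a at hx
    change nameMap θ y = b at hy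
    change nameMap θ z = c at hz
    subst hx hy hz
    exact ⟨x, y, rfl, rfl, by rw [(key x y z).1 h]⟩
  · rintro ⟨x, y, rfl, rfl, rfl⟩
    exact (key _ _ _).2 rfl

theorem inUniv_structureCode_iff (θ : G.univ ≃[groupLang] Heisenberg F) {a : ℕ} :
    InUniv (structureCode G) a ↔ ∃ x, nameMap θ x = a := by
  rw [InUniv, structureCode, charFun_eq_one_iff, eqCode_mem_atomicDiagram θ.symm (by simp)]
  simp [nameMap]

end GroupDiagram

/-! ### Correctness of the searches -/

section Correctness

variable {F : Type u} [Field F] {G : OmegaStructure groupLang}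

/-- The name in `G` of the element `g_(u,v)(α)` of `F_(u,v)`. -/
noncomputable def fieldName (θ : G.univ ≃[groupLang] Heisenberg F) (w : NCPair (Heisenberg F))
    (α : F) : ℕ :=
  nameMap θ (gMap w α).toH

variable (θ : G.univ ≃[groupLang] Heisenberg F) (w : NCPair (Heisenberg F))

theorem fieldName_injective : Function.Injective (fieldName θ w) :=
  (names_structureCode θ).inj.comp (toH_injective.comp (gEquiv w).injective)

/-- The field `F_w` as it is defined in `G`. -/
noncomputable def fieldCopy : OmegaStructure fieldLang :=
  imageStructure (fieldName θ w) (fieldName_injective θ w)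

/-- Soundness of certificates: addition is multiplication of central elements, and in a certified
product the factors α, β are pinned down by injectivity of g_w. -/
theorem fieldOp_via {r m : ℕ} {x y : F} {f : ℕ → ℕ} (hr : r < 2)
    (h₀ : r = 0 → MulTrue (structureCode G) (fieldName θ w x) (fieldName θ w y) m)
    (h₁ : r = 1 → MulVia (MulTrue (structureCode G)) (nameMap θ w.1.1) (nameMap θ w.1.2)
      (fieldName θ w x) (fieldName θ w y) m f) : fieldName θ w (fieldOp r x y) = m := by
  have hN := names_structureCode θ
  interval_cases r
  · rw [← hN.eq_of_rel (h₀ rfl)]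
    change nameMap θ (hElem 0 0 ((x + y) * _)) = nameMap θ (hElem 0 0 _ * hElem 0 0 _)
    rw [hElem_center_mul, add_mul]
  · obtain ⟨x', y', z', hx, hy, rfl, hm⟩ := hN.exists_of_mulVia (h₁ rfl)
    obtain rfl := hN.inj hx
    obtain rfl := hN.inj hy
    have hm' : MaltsevMul w.1.1 w.1.2 (gMap w x).toH (gMap w y).toH (gMap w (x * y)).toH :=
      (maltsevMul_iff w.Delta_ne_zero).2 ⟨x, y, rfl, rfl, rfl⟩
    rw [maltsevMul_iff w.Delta_ne_zero] at hm
    obtain ⟨α, β, hα, hβ, rfl⟩ := hm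
    have e₁ : gMap w x = gMap w α := toH_injective hα
    have e₂ : gMap w y = gMap w β := toH_injective hβ
    rw [(gEquiv w).injective e₁, (gEquiv w).injective e₂]
    rfl

theorem exists_fieldOp_via (r : ℕ) (x y : F) : ∃ m, ∃ f : ℕ → ℕ,
    (r = 0 → MulTrue (structureCode G) (fieldName θ w x) (fieldName θ w y) m) ∧
    (r = 1 → MulVia (MulTrue (structureCode G)) (nameMap θ w.1.1) (nameMap θ w.1.2)
      (fieldName θ w x) (fieldName θ w y) m f) := by
  have hN := names_structureCode θ
  by_cases hr : r = 0
  · exact ⟨_, fun _ => 0, fun _ => hN.mul _ _, fun h => by omega⟩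
  · have hm : MaltsevMul w.1.1 w.1.2 (gMap w x).toH (gMap w y).toH (gMap w (x * y)).toH :=
      (maltsevMul_iff w.Delta_ne_zero).2 ⟨x, y, rfl, rfl, rfl⟩
    obtain ⟨f, hf⟩ := hN.exists_mulVia hm
    exact ⟨_, f, fun h => absurd h hr, fun _ => hf⟩

theorem exists_fieldName_of_centralVia {a p q : ℕ}
    (h : CentralVia (structureCode G) (nameMap θ w.1.1) (nameMap θ w.1.2) a p q) :
    ∃ x, fieldName θ w x = a := by
  have hN := names_structureCode θ
  obtain ⟨x, u, rfl, hu, hxu⟩ := hN.exists_of_commutesVia h.1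
  obtain ⟨x', v, hx, hv, hxv⟩ := hN.exists_of_commutesVia h.2
  obtain rfl := hN.inj hx
  obtain rfl := hN.inj hu
  obtain rfl := hN.inj hv
  rw [comm_eq_iff, mul_one] at hxu hxv
  obtain ⟨α, rfl⟩ := mem_center_of_commute w.Delta_ne_zero hxu hxv
  exact ⟨α, rfl⟩

/-- Once the products x u = p and x v = q are known, centrality is decided by checking u x = p and v
x = q. If a is not in the universe, no product involving it is true, so the test fails as it should.
-/
theorem centralVia_iff {a p q : ℕ}
    (h : CentralSettled (structureCode G) (nameMap θ w.1.1) (nameMap θ w.1.2) a p q) :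
    CentralVia (structureCode G) (nameMap θ w.1.1) (nameMap θ w.1.2) a p q ↔
      ∃ x, fieldName θ w x = a := by
  refine ⟨exists_fieldName_of_centralVia θ w, ?_⟩
  rintro ⟨x, rfl⟩
  have hN := names_structureCode θ
  obtain ⟨h₁, h₂⟩ := h ((inUniv_structureCode_iff θ).2 ⟨_, rfl⟩)
  have hc : ∀ y : Heisenberg F, (gMap w x).toH * y = y * (gMap w x).toH := fun y =>
    (Subgroup.mem_center_iff.1 (gMap w x).2 y).symm
  refine ⟨⟨h₁, ?_⟩, h₂, ?_⟩
  · rw [← hN.eq_of_rel h₁, hc]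
    exact hN.mul _ _
  · rw [← hN.eq_of_rel h₂, hc]
    exact hN.mul _ _

theorem exists_centralSettled (a : ℕ) : ∃ p q,
    CentralSettled (structureCode G) (nameMap θ w.1.1) (nameMap θ w.1.2) a p q := by
  by_cases h : InUniv (structureCode G) a
  · have hN := names_structureCode θ
    obtain ⟨x, rfl⟩ := (inUniv_structureCode_iff θ).1 h
    exact ⟨_, _, fun _ => ⟨hN.mul _ _, hN.mul _ _⟩⟩
  · exact ⟨0, 0, fun h' => absurd h' h⟩

/-- Termination of the search on every k: products exist inside the group, and outside the relevant
universe the requirements are vacuous. -/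
theorem exists_fieldSettled (k : ℕ) : ∃ f,
    FieldSettled (structureCode G) (nameMap θ w.1.1) (nameMap θ w.1.2) k f := by
  choose p q hpq using exists_centralSettled θ w
  by_cases hE : IsEqCode k
  -- Truncated subtraction gives slots below 10 an arbitrary value; equations do not read them.
  · refine ⟨fun i => [p (eqLeft k), q (eqLeft k), p (eqRight k), q (eqRight k)].getD (i - 10) 0,
      fun _ => ⟨hpq _, hpq _⟩, fun h => absurd h (not_isRelCode hE)⟩
  · obtain ⟨m, f, hf⟩ : ∃ m, ∃ f : ℕ → ℕ,
        ((∃ x, fieldName θ w x = relArg k 0) ∧ ∃ y, fieldName θ w y = relArg k 1) →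
        (relSymbol k = 0 → MulTrue (structureCode G) (relArg k 0) (relArg k 1) m) ∧
        (relSymbol k = 1 → MulVia (MulTrue (structureCode G)) (nameMap θ w.1.1) (nameMap θ w.1.2)
          (relArg k 0) (relArg k 1) m f) := by
      by_cases h : (∃ x, fieldName θ w x = relArg k 0) ∧ ∃ y, fieldName θ w y = relArg k 1
      · obtain ⟨⟨x, hx⟩, y, hy⟩ := h
        obtain ⟨m, f, hf⟩ := exists_fieldOp_via θ w (relSymbol k) x y
        rw [hx, hy] at hf
        exact ⟨m, f, fun _ => hf⟩
      · exact ⟨0, fun _ => 0, fun h' => absurd h' h⟩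
    refine ⟨fun i => if i < 10 then f i else [p (relArg k 0), q (relArg k 0), p (relArg k 1),
      q (relArg k 1), p (relArg k 2), q (relArg k 2), m].getD (i - 10) 0,
      fun h => absurd h hE, fun _ => ⟨hpq _, hpq _, hpq _, fun h => ?_⟩⟩
    exact hf ⟨exists_fieldName_of_centralVia θ w h.1, exists_fieldName_of_centralVia θ w h.2⟩

theorem fieldValue_iff {k : ℕ} {f : ℕ → ℕ}
    (hf : FieldSettled (structureCode G) (nameMap θ w.1.1) (nameMap θ w.1.2) k f) :
    FieldValue (structureCode G) (nameMap θ w.1.1) (nameMap θ w.1.2) k f ↔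
      k ∈ atomicDiagram (fieldCopy θ w) := by
  let e : F ≃[fieldLang] (fieldCopy θ w).univ :=
    imageEquiv (fieldName θ w) (fieldName_injective θ w)
  have he : ∀ x, (e x : ℕ) = fieldName θ w x := fun _ => rfl
  by_cases hE : IsEqCode k
  · obtain ⟨h₁, h₂⟩ := hf.1 hE
    have hk := hE.2
    have hd := eqCode_mem_atomicDiagram e (a := eqLeft k) (b := eqRight k) hE.1
    rw [← hk] at hd
    rw [hd, FieldValue, centralVia_iff θ w h₁, centralVia_iff θ w h₂]
    simp only [hE, not_isRelCode hE, true_and, false_and, or_false, he]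
  by_cases hR : IsRelCode k
  · obtain ⟨h₁, h₂, h₃, h₄⟩ := hf.2 hR
    have hd := relCode_mem_atomicDiagram e (a := relArg k 0) (b := relArg k 1) (c := relArg k 2)
      hR.1 hR.2.1
    rw [← hR.2.2] at hd
    rw [centralVia_iff θ w h₁, centralVia_iff θ w h₂] at h₄
    rw [hd, FieldValue, centralVia_iff θ w h₁, centralVia_iff θ w h₂, centralVia_iff θ w h₃]
    simp only [hE, hR, true_and, false_and, false_or, he]
    constructor
    · rintro ⟨⟨x, hx⟩, ⟨y, hy⟩, ⟨z, hz⟩, h⟩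
      have hm := h₄ ⟨⟨x, hx⟩, y, hy⟩
      rw [← hx, ← hy] at hm
      have hop := fieldOp_via θ w hR.2.1 hm.1 hm.2
      -- The sentence is tested by comparing the computed value in slot 16 with the third argument;
      -- injectivity of the names turns this into an equation in F, for the positive and the negated
      -- sentence at once.
      rw [← hop, ← hz, (fieldName_injective θ w).eq_iff] at h
      exact ⟨x, y, z, hx, hy, hz, h⟩
    · rintro ⟨x, y, z, hx, hy, hz, h⟩
      refine ⟨⟨x, hx⟩, ⟨y, hy⟩, ⟨z, hz⟩, ?_⟩
      have hm := h₄ ⟨⟨x, hx⟩, y, hy⟩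
      rw [← hx, ← hy] at hm
      have hop := fieldOp_via θ w hR.2.1 hm.1 hm.2
      rwa [← hop, ← hz, (fieldName_injective θ w).eq_iff]
  · refine iff_of_false ?_ fun h => (mem_fieldDiagram_cases h).elim hE hR
    rintro (h | h)
    exacts [hE h.1, hR h.1]

end Correctness

/-! ### Correctness of the search for images under the transfer map -/

section MapCorrectness

variable {F : Type u} [Field F] {G₁ G₂ : OmegaStructure groupLang}
  (θ₁ : G₁.univ ≃[groupLang] Heisenberg F) (θ₂ : G₂.univ ≃[groupLang] Heisenberg F)
  (w₁ w₂ : NCPair (Heisenberg F)) {P : ℕ → ℕ}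
  (hP : ∀ x b, P (Nat.pair (nameMap θ₁ x) b) = 1 ↔ nameMap θ₂ x = b)
include hP

theorem exists_mapSettled (a : ℕ) : ∃ f,
    MapSettled (structureCode G₁) P (structureCode G₂) (nameMap θ₁ w₁.1.1) (nameMap θ₁ w₁.1.2)
      (nameMap θ₂ w₂.1.1) (nameMap θ₂ w₂.1.2) a f := by
  have hN := names_structureCode θ₂
  obtain ⟨p, q, hpq⟩ := exists_centralSettled θ₁ w₁ a
  by_cases h : ∃ x, fieldName θ₁ w₁ x = a
  · obtain ⟨x, rfl⟩ := h
    obtain ⟨f, hf⟩ := hN.exists_mulVia (maltsevMul_comm_iff.2 ⟨x, rfl, rfl⟩ :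
      MaltsevMul w₁.1.1 w₁.1.2 _ (comm w₂.1.1 w₂.1.2) _)
    -- Slots 10 to 12 certify the commutator of w₂, 13 and 14 centrality, 15 to 17 hold the images
    -- of the pair w₁ and of the argument in G₂, and 18 holds the result.
    refine ⟨fun i => if i < 10 then f i else [nameMap θ₂ (comm w₂.1.1 w₂.1.2),
      nameMap θ₂ (w₂.1.1 * w₂.1.2), nameMap θ₂ (w₂.1.2 * w₂.1.1), p, q, nameMap θ₂ w₁.1.1,
      nameMap θ₂ w₁.1.2, nameMap θ₂ (gMap w₁ x).toH, nameMap θ₂ (gMap w₂ x).toH].getD (i - 10) 0,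
      hpq, fun _ => ⟨(hP _ _).2 rfl, (hP _ _).2 rfl, (hP _ _).2 rfl, hN.commVia _ _, hf⟩⟩
  · exact ⟨fun i => [p, q].getD (i - 13) 0, hpq,
      fun h' => absurd (exists_fieldName_of_centralVia θ₁ w₁ h') h⟩

theorem mapValue_iff {a b : ℕ} {f : ℕ → ℕ}
    (hf : MapSettled (structureCode G₁) P (structureCode G₂) (nameMap θ₁ w₁.1.1)
      (nameMap θ₁ w₁.1.2) (nameMap θ₂ w₂.1.1) (nameMap θ₂ w₂.1.2) a f) :
    MapValue (structureCode G₁) (nameMap θ₁ w₁.1.1) (nameMap θ₁ w₁.1.2) a b f ↔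
      ∃ x, fieldName θ₁ w₁ x = a ∧ fieldName θ₂ w₂ x = b := by
  have hN := names_structureCode θ₂
  obtain ⟨h₁, h₂⟩ := hf
  rw [centralVia_iff θ₁ w₁ h₁] at h₂
  rw [MapValue, centralVia_iff θ₁ w₁ h₁]
  -- Every settling certificate has the same value in slot 18, so the answer does not depend on
  -- which one the search meets.
  have key : ∀ x, fieldName θ₁ w₁ x = a → fieldName θ₂ w₂ x = f 18 := by
    rintro x rfl
    obtain ⟨hu, hv, hx, he, hm⟩ := h₂ ⟨x, rfl⟩
    rw [hP] at hu hv
    have hx' := (hP _ _).1 hx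
    rw [← hu, ← hv, ← hx'] at hm
    obtain ⟨x', e', z', hx', he', hz', hm⟩ := hN.exists_of_mulVia hm
    obtain ⟨u, v, hu, hv, he⟩ := hN.exists_of_commVia he
    obtain rfl := hN.inj hu
    obtain rfl := hN.inj hv
    obtain rfl := hN.inj hx'
    obtain rfl := hN.inj (he'.trans he.symm)
    obtain ⟨α, hα, rfl⟩ := maltsevMul_comm_iff.1 hm
    have e₁ : gMap w₁ x = gMap w₁ α := toH_injective hα
    obtain rfl := (gEquiv w₁).injective e₁
    exact hz'
  constructor
  · rintro ⟨⟨x, hx⟩, rfl⟩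
    exact ⟨x, hx, key x hx⟩
  · rintro ⟨x, hx, rfl⟩
    exact ⟨⟨x, hx⟩, (key x hx).symm⟩

end MapCorrectness

/-! ### The functor -/

theorem TuringOperator.Takes.unique {c : TuringOperator} {A B B' : ℕ → ℕ} (h : c.Takes A B)
    (h' : c.Takes A B') : B = B' := by
  funext n
  exact Part.some_inj.1 ((h n).symm.trans (h' n))

/-- The program `c` finds the pair `w` in `G`. -/
def FindsPair (c : TuringOperator) (G : OmegaStructure groupLang) (w : NCPair G.univ) : Prop :=
  ∃ n, c.eval (structureCode G) 0 = Part.some n ∧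
    n.unpair.1 = w.1.1 ∧ n.unpair.2.unpair.1 = w.1.2

theorem charFun_cases (S : Set ℕ) (k : ℕ) {Q : Prop} (h : Q ↔ k ∈ S) :
    (Q ∧ charFun S k = 1) ∨ (¬ Q ∧ charFun S k = 0) := by
  rw [charFun_eq_one_iff, charFun_eq_zero_iff, h]
  tauto

/-! ### Copies of the fields and the maps between them, indexed by F -/

section Copies

variable {F : Type u} [Field F] {G G₁ G₂ : OmegaStructure groupLang}

/-- The isomorphism from `F` onto the copy of `F_w` in `G`. -/
noncomputable def fieldCopyEquiv (θ : G.univ ≃[groupLang] Heisenberg F)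
    (w : NCPair (Heisenberg F)) : F ≃[fieldLang] (fieldCopy θ w).univ :=
  imageEquiv (fieldName θ w) (fieldName_injective θ w)

/-- Elements of F_w are determined by their values in H(F), so θ allows exactly one restriction κ.
-/
theorem isRestriction_iff {θ : G.univ ≃[groupLang] Heisenberg F} {w : NCPair (Heisenberg F)}
    {κ : (fieldCopy θ w).univ ≃[fieldLang] MaltsevField w} :
    IsRestriction θ κ ↔ ∀ α, κ (fieldCopyEquiv θ w α) = gMap w α := by
  have key : ∀ α, ∃ h : (fieldCopyEquiv θ w α : ℕ) ∈ G.univ,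
      θ ⟨fieldCopyEquiv θ w α, h⟩ = (gMap w α).toH := fun α =>
    ⟨(θ.symm (gMap w α).toH).2, θ.apply_symm_apply _⟩
  constructor
  · intro h α
    obtain ⟨h₁, h₂⟩ := h (fieldCopyEquiv θ w α)
    obtain ⟨h₁', h₃⟩ := key α
    exact toH_injective (h₂.symm.trans h₃)
  · intro h x
    obtain ⟨α, rfl⟩ := (fieldCopyEquiv θ w).surjective x
    rw [h]
    exact key α

/-- The graph of the isomorphism between the copies of two fields. -/
def transferGraph (θ₁ : G₁.univ ≃[groupLang] Heisenberg F) (w₁ : NCPair (Heisenberg F))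
    (θ₂ : G₂.univ ≃[groupLang] Heisenberg F) (w₂ : NCPair (Heisenberg F)) : Set ℕ :=
  {k | ∃ α, k = Nat.pair (fieldName θ₁ w₁ α) (fieldName θ₂ w₂ α)}

/-- Translates an output of Ψ into the statement that q preserves the index in F, from which
identity and composition follow at once. -/
theorem mapCode_eq_iff {θ₁ : G₁.univ ≃[groupLang] Heisenberg F} {w₁ : NCPair (Heisenberg F)}
    {θ₂ : G₂.univ ≃[groupLang] Heisenberg F} {w₂ : NCPair (Heisenberg F)}
    {q : (fieldCopy θ₁ w₁).univ ≃[fieldLang] (fieldCopy θ₂ w₂).univ} :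
    mapCode q = charFun (transferGraph θ₁ w₁ θ₂ w₂) ↔
      ∀ α, q (fieldCopyEquiv θ₁ w₁ α) = fieldCopyEquiv θ₂ w₂ α := by
  have key : graphCode q = {k | ∃ α, k = Nat.pair (fieldName θ₁ w₁ α)
      (q (fieldCopyEquiv θ₁ w₁ α))} := by
    ext k
    constructor
    · rintro ⟨x, rfl⟩
      obtain ⟨α, rfl⟩ := (fieldCopyEquiv θ₁ w₁).surjective x
      exact ⟨α, rfl⟩
    · rintro ⟨α, rfl⟩
      exact ⟨fieldCopyEquiv θ₁ w₁ α, rfl⟩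
  rw [mapCode, charFun_injective.eq_iff, key]
  constructor
  · intro h α
    have hα : Nat.pair (fieldName θ₁ w₁ α) (q (fieldCopyEquiv θ₁ w₁ α)) ∈
        transferGraph θ₁ w₁ θ₂ w₂ := h ▸ ⟨α, rfl⟩
    obtain ⟨β, hβ⟩ := hα
    rw [Nat.pair_eq_pair] at hβ
    obtain rfl := fieldName_injective θ₁ w₁ hβ.1
    exact Subtype.ext hβ.2
  · intro h
    ext k
    simp only [h]
    rfl

end Copies

/-- The programs are fixed before the field. The pair found depends only on the diagram of G, not on
θ, and the last two clauses hold for every θ, so θ may later be chosen compatibly along p. -/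
theorem exists_operators : ∃ c Φ Ψ : TuringOperator, ∀ (F : Type u) [Field F],
    (∀ G : OmegaStructure groupLang, G.IsCopy (Heisenberg F) → ∃ w, FindsPair c G w) ∧
    (∀ (G : OmegaStructure groupLang) (w : NCPair G.univ), FindsPair c G w →
      ∀ θ : G.univ ≃[groupLang] Heisenberg F,
        Φ.Takes (structureCode G) (structureCode (fieldCopy θ (w.map θ)))) ∧
    ∀ (G₁ G₂ : OmegaStructure groupLang) (w₁ : NCPair G₁.univ) (w₂ : NCPair G₂.univ),
      FindsPair c G₁ w₁ → FindsPair c G₂ w₂ →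
      ∀ (p : G₁.univ ≃[groupLang] G₂.univ) (θ : G₂.univ ≃[groupLang] Heisenberg F),
        Ψ.Takes (tripleCode p)
          (charFun (transferGraph (θ.comp p) (w₁.map (θ.comp p)) θ (w₂.map θ))) := by
  obtain ⟨c, hc⟩ := exists_pairOperator
  obtain ⟨Φ, hΦ⟩ := exists_fieldOperator c
  obtain ⟨Ψ, hΨ⟩ := exists_mapOperator c
  refine ⟨c, Φ, Ψ, fun F _ => ⟨?_, ?_, ?_⟩⟩
  · rintro G ⟨θ⟩
    have hN := names_structureCode θ
    obtain ⟨n, ⟨h₁, h₂⟩, hn⟩ := hc (structureCode G) (by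
      -- These two elements have Δ = 1, so they do not commute over any field.
      let x : Heisenberg F := hElem 1 0 0
      let y : Heisenberg F := hElem 0 1 0
      refine ⟨Nat.pair (nameMap θ x) (Nat.pair (nameMap θ y) (nameMap θ (x * y))), ?_⟩
      simp only [CodesPair, Nat.unpair_pair]
      refine ⟨hN.mul _ _, fun h => ?_⟩
      have h' := commute_iff_Delta.1 (hN.inj (hN.eq_of_rel h)).symm
      simp [x, y, Delta_hElem] at h')
    obtain ⟨x, y, hx, hy, hxy⟩ := (hN.iff _ _ _).1 h₁
    rw [← hx, ← hy, ← hxy] at h₂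
    have hne : x * y ≠ y * x := fun h => h₂ (by rw [h]; exact hN.mul _ _)
    refine ⟨⟨(θ.symm x, θ.symm y), ?_⟩, n, hn, hx.symm, hy.symm⟩
    rintro ⟨z, hz₁, hz₂⟩
    have key : ∀ a b : Heisenberg F, IsMul (θ.symm a) (θ.symm b) z → a * b = θ z := by
      intro a b h
      rw [← isMul_iff]
      unfold IsMul at h ⊢
      rw [← θ.symm.map_rel]
      convert h using 1
      funext i
      fin_cases i <;> simp
    exact hne ((key _ _ hz₁).trans (key _ _ hz₂).symm)
  · rintro G w ⟨n, hn, hu, hv⟩ θ k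
    have hu' : n.unpair.1 = nameMap θ (w.map θ).1.1 := by simp [hu, nameMap, NCPair.map]
    have hv' : n.unpair.2.unpair.1 = nameMap θ (w.map θ).1.2 := by simp [hv, nameMap, NCPair.map]
    refine hΦ _ n hn k _ ?_ fun f hf => ?_
    · rw [hu', hv']
      exact exists_fieldSettled θ _ k
    · rw [hu', hv'] at hf ⊢
      exact charFun_cases _ _ (fieldValue_iff θ _ hf)
  · rintro G₁ G₂ w₁ w₂ ⟨n, hn, hu₁, hv₁⟩ ⟨m, hm, hu₂, hv₂⟩ p θ k
    have hu₁' : n.unpair.1 = nameMap (θ.comp p) (w₁.map (θ.comp p)).1.1 := by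
      rw [hu₁]; exact congrArg _ ((θ.comp p).symm_apply_apply _).symm
    have hv₁' : n.unpair.2.unpair.1 = nameMap (θ.comp p) (w₁.map (θ.comp p)).1.2 := by
      rw [hv₁]; exact congrArg _ ((θ.comp p).symm_apply_apply _).symm
    have hu₂' : m.unpair.1 = nameMap θ (w₂.map θ).1.1 := by simp [hu₂, nameMap, NCPair.map]
    have hv₂' : m.unpair.2.unpair.1 = nameMap θ (w₂.map θ).1.2 := by
      simp [hv₂, nameMap, NCPair.map]
    -- With G₁ named through θ ∘ p and G₂ through θ, the map p becomes the identity of H(F).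
    have hP : ∀ x b, mapCode p (Nat.pair (nameMap (θ.comp p) x) b) = 1 ↔ nameMap θ x = b := by
      intro x b
      rw [mapCode, charFun_eq_one_iff, nameMap, mem_graphCode_iff]
      have : p ((θ.comp p).symm x) = θ.symm x := by
        apply θ.injective
        rw [θ.apply_symm_apply]
        exact (θ.comp p).apply_symm_apply x
      rw [this]
      rfl
    obtain ⟨x, y, rfl⟩ : ∃ x y, k = Nat.pair x y := ⟨_, _, (Nat.pair_unpair k).symm⟩
    refine hΨ _ _ _ n m hn hm x y _ ?_ fun f hf => ?_
    · rw [hu₁', hv₁', hu₂', hv₂']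
      exact exists_mapSettled _ _ _ _ hP x
    · rw [hu₁', hv₁', hu₂', hv₂'] at hf
      rw [hu₁', hv₁']
      refine charFun_cases _ _ ((mapValue_iff _ _ _ _ hP hf).trans ?_)
      simp only [transferGraph, Set.mem_ofPred_eq, Nat.pair_eq_pair, eq_comm]

end HeisenbergFunctor

open HeisenbergFunctor
open scoped FirstOrder
theorem mainTheorem7 :
    ∃ (Φ Ψ : TuringOperator) (ψ : groupLang.Formula (Fin 6)),
      ψ.IsExistential ∧
      ∀ (F : Type u) [Field F],
        IsComputableFunctor groupLang fieldLang Φ Ψ (Heisenberg F) F ∧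
        ∃ f : ∀ w w' : NCPair (Heisenberg F), MaltsevField w ≃[fieldLang] MaltsevField w',
          -- `f_(w,w')` is the isomorphism `g_w' ∘ g_w⁻¹`, and this family is functorial
          (∀ w w' α, f w w' (gMap w α) = gMap w' α) ∧
          (∀ w, f w w = FirstOrder.Language.Equiv.refl fieldLang (MaltsevField w)) ∧
          (∀ w w' w'', f w w'' = (f w' w'').comp (f w w')) ∧
          -- `ψ` defines `f_(w,w')` in `H(F)`
          (∀ (w w' : NCPair (Heisenberg F)) (x y : Heisenberg F),
            ψ.Realize ![w.1.1, w.1.2, w'.1.1, w'.1.2, x, y] ↔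
              ∃ a : MaltsevField w, a.toH = x ∧ (f w w' a).toH = y) ∧
          -- with suitable non-commuting pairs `c G`, the field `Φ(G)` is the one defined in `G`
          -- from `c G`, and `Ψ(G₁, p, G₂)` is `p` followed by `f_(p(c G₁), c G₂)`
          ∃ c : ∀ G : OmegaStructure groupLang, G.IsCopy (Heisenberg F) → NCPair G.univ,
            (∀ (G : OmegaStructure groupLang) (hG : G.IsCopy (Heisenberg F))
                (K : OmegaStructure fieldLang), Φ.Takes (structureCode G) (structureCode K) →
              ∀ θ : G.univ ≃[groupLang] Heisenberg F,
                ∃ κ : K.univ ≃[fieldLang] MaltsevField ((c G hG).map θ), IsRestriction θ κ) ∧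
            (∀ (G₁ G₂ : OmegaStructure groupLang) (h₁ : G₁.IsCopy (Heisenberg F))
                (h₂ : G₂.IsCopy (Heisenberg F)) (K₁ K₂ : OmegaStructure fieldLang),
              Φ.Takes (structureCode G₁) (structureCode K₁) →
              Φ.Takes (structureCode G₂) (structureCode K₂) →
              ∀ (p : G₁.univ ≃[groupLang] G₂.univ) (q : K₁.univ ≃[fieldLang] K₂.univ),
                Ψ.Takes (tripleCode p) (mapCode q) →
                ∀ (θ : G₂.univ ≃[groupLang] Heisenberg F)
                  (κ₁ : K₁.univ ≃[fieldLang] MaltsevField ((c G₁ h₁).map (θ.comp p)))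
                  (κ₂ : K₂.univ ≃[fieldLang] MaltsevField ((c G₂ h₂).map θ)),
                  IsRestriction (θ.comp p) κ₁ → IsRestriction θ κ₂ →
                  ∀ x : K₁.univ, κ₂ (q x) = f _ _ (κ₁ x)) := by
  obtain ⟨c, Φ, Ψ, h⟩ := exists_operators.{u}
  refine ⟨Φ, Ψ, transferFormula, isExistential_transferFormula, fun F _ => ?_⟩
  obtain ⟨hc, hΦ, hΨ⟩ := h F
  choose w hw using hc
  -- The structure coded by Φ(G) equals the field copy built from any θ whatsoever; θ can thus be
  -- adapted to each clause.
  have hK : ∀ (G : OmegaStructure groupLang) (hG : G.IsCopy (Heisenberg F))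
      (K : OmegaStructure fieldLang), Φ.Takes (structureCode G) (structureCode K) →
      ∀ θ : G.univ ≃[groupLang] Heisenberg F, K = fieldCopy θ ((w G hG).map θ) :=
    fun G hG K hK θ => structureCode_injective (hK.unique (hΦ G _ (hw G hG) θ))
  refine ⟨⟨?_, ?_, ?_, ?_⟩, fEquiv, fEquiv_gMap, fEquiv_self, fEquiv_comp, ?_, w, ?_, ?_⟩
  · intro G hG
    -- `id` keeps `hG` in the context, since the chosen pair depends on it.
    obtain ⟨θ⟩ := id hG
    exact ⟨_, ⟨(fieldCopyEquiv θ _).symm⟩, hΦ G _ (hw G hG) θ⟩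
  · intro G₁ G₂ K₁ K₂ h₁ h₂ hK₁ hK₂ p
    obtain ⟨θ⟩ := id h₂
    obtain rfl := hK G₁ h₁ K₁ hK₁ (θ.comp p)
    obtain rfl := hK G₂ h₂ K₂ hK₂ θ
    refine ⟨(fieldCopyEquiv θ _).comp (fieldCopyEquiv (θ.comp p) _).symm, ?_⟩
    rw [mapCode_eq_iff.2 fun α => by simp]
    exact hΨ G₁ G₂ _ _ (hw G₁ h₁) (hw G₂ h₂) p θ
  · intro G K hG hKG
    obtain ⟨θ⟩ := id hG
    obtain rfl := hK G hG K hKG θ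
    rw [mapCode_eq_iff.2 fun α => rfl]
    exact hΨ G G _ _ (hw G hG) (hw G hG) (FirstOrder.Language.Equiv.refl groupLang G.univ) θ
  · intro G₁ G₂ G₃ K₁ K₂ K₃ h₁ h₂ h₃ hK₁ hK₂ hK₃ p₁ p₂ q₁ q₂ hq₁ hq₂
    obtain ⟨θ⟩ := id h₃
    -- All three groups are read through one isomorphism θ from the last one, pulled back along p₂
    -- and p₁.
    obtain rfl := hK G₁ h₁ K₁ hK₁ ((θ.comp p₂).comp p₁)
    obtain rfl := hK G₂ h₂ K₂ hK₂ (θ.comp p₂)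
    obtain rfl := hK G₃ h₃ K₃ hK₃ θ
    have e₁ := mapCode_eq_iff.1
      (hq₁.unique (hΨ G₁ G₂ _ _ (hw G₁ h₁) (hw G₂ h₂) p₁ (θ.comp p₂)))
    have e₂ := mapCode_eq_iff.1 (hq₂.unique (hΨ G₂ G₃ _ _ (hw G₂ h₂) (hw G₃ h₃) p₂ θ))
    rw [mapCode_eq_iff.2 fun α => (congrArg q₂ (e₁ α)).trans (e₂ α)]
    exact hΨ G₁ G₃ _ _ (hw G₁ h₁) (hw G₃ h₃) (p₂.comp p₁) θ
  · intro w w' x y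
    rw [realize_transferFormula, maltsevMul_comm_iff_fEquiv]
  · intro G hG K hKG θ
    obtain rfl := hK G hG K hKG θ
    exact ⟨(gEquiv _).comp (fieldCopyEquiv θ _).symm,
      isRestriction_iff.2 fun α => by simp [gEquiv_apply]⟩
  · intro G₁ G₂ h₁ h₂ K₁ K₂ hK₁ hK₂ p q hq θ κ₁ κ₂ hκ₁ hκ₂ x
    obtain rfl := hK G₁ h₁ K₁ hK₁ (θ.comp p)
    obtain rfl := hK G₂ h₂ K₂ hK₂ θ
    have e := mapCode_eq_iff.1 (hq.unique (hΨ G₁ G₂ _ _ (hw G₁ h₁) (hw G₂ h₂) p θ))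
    obtain ⟨α, rfl⟩ := (fieldCopyEquiv (θ.comp p) _).surjective x
    rw [e, isRestriction_iff.1 hκ₁, isRestriction_iff.1 hκ₂, fEquiv_gMap]
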